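/- \textbf{Notions.} $\mathrm{negl}$ denotes a function decaying faster than every inverse polynomial; bits are added mod 2; $H$ is the Hadamard matrix. For a finite set $T$ of bit strings, $|T\rangle=|T|^{-1/2}\sum_{u\in T}|u\rangle$. For a matrix $A\in\mathbb Z_2^{k\times d}$ and $v\in\mathbb Z_2^k$ let $S=\{Az+v: z\in\mathbb Z_2^d\}$, $S_b=\{u\in S:u_1=b\}$ and $S^\perp=\{s: s^{\top}A=0\}$. \emph{Pauli functional commitment (PFC) and correctness.} A PFC consists of key generation $\mathsf{Gen}(1^\lambda)\to(\mathsf{CK},\mathsf{dk})$; a quantum map $\mathsf{Com}^{\mathsf{CK}}(b)$, applied controlled on a qubit $\mathcal B$, which outputs a classical string $c$ and a register $\mathcal U$; measurements $\mathsf{OpenZ},\mathsf{OpenX}$ of $(\mathcal B,\mathcal U)$; and deterministic decoders $\mathsf{DecZ},\mathsf{DecX}$ taking $(\mathsf{dk},c,\text{opening})$ to $\{0,1,\bot\}$. It is correct if there is one negligible $\varepsilon$ such that for all $\lambda$ and all (possibly mixed) states $\rho$ of $\mathcal B$, the distribution on $\{0,1,\bot\}$ obtained by $\mathsf{Gen}$,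 $\mathsf{Com}^{\mathsf{CK}}$ on $\rho$, $\mathsf{OpenZ}$ (resp. $\mathsf{OpenX}$), $\mathsf{DecZ}$ (resp. $\mathsf{DecX}$) is within total variation distance $\varepsilon(\lambda)$ of the outcome of measuring $\rho$ in the standard (resp. Hadamard) basis. \emph{Ingredients.} (1) A one-shot signature scheme $\mathsf{OSS}$ for one-bit messages: $\mathsf{Setup}$ maps random coins to a classical oracle $\mathcal O$; $\mathsf{Gen}^{\mathcal O}$ samples a classical $\mathsf{vk}$ and a quantum state $|\mathsf{sk}\rangle$; $\mathsf{Sign}^{\mathcal O}(|\mathsf{sk}\rangle,m)$ is a unitary followed by a measurement of the signature register; $\mathsf{Ver}^{\mathcal O}(\mathsf{vk},m,\sigma)$ is deterministic. The length of $\mathsf{vk}$ is polynomial in $\lambda$, and $\mathsf{OSS}$ is correct: for $m\in\{0,1\}$ an honest signature of $m$ is accepted with probability $1-\mathrm{negl}(\lambda)$. (2) The coset-based scheme $\overline{\mathsf{OSS}}$ with $s=16\lambda$, $r=s(\lambda-1)$, $n=k=r+\tfrac32 s$. Its setup randomness is a uniformly random pair of a permutation $\Pi$ of $\{0,1\}^n$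 and a function $y\in\{0,1\}^r\mapsto(A_y,b_y)$, with $A_y\in\mathbb Z_2^{k\times(n-r)}$ of full column rank and $b_y\in\mathbb Z_2^k$. Write $\Pi(x)=h(x)\|j(x)$ with $|h(x)|=r$, and $S_y,S_{y,b},S_y^\perp$ for the sets above with $(A,v)=(A_y,b_y)$. The oracles are $P(x)=(y,A_yj(x)+b_y)$ with $y=h(x)$; $P^{-1}(y,u)=\Pi^{-1}(y\|z)$ if $u=A_yz+b_y$ and $\bot$ if $u\notin S_y$; and $D(y,u)=1$ iff $u\in S_y^\perp$ (else $0$). $\overline{\mathsf{OSS}}.\mathsf{Gen}$ prepares $2^{-n/2}\sum_x|x\rangle|P(x)\rangle$, measures $y$, uncomputes $x$ with $P^{-1}$, and outputs $y$ and the remaining register. (3) A pseudorandom function $F_\kappa$ (key $\kappa$) mapping strings $\mathsf{vk}$ to setup randomness of $\overline{\mathsf{OSS}}$: no non-uniform family of polynomial-size oracle circuits, which may query the individual bits of $\Pi(x)$, $A_y$, $b_y$ for the setup randomness at any chosen $\mathsf{vk}$, distinguishes $F_\kappa$ with random $\kappa$ from a uniformly random function with non-negligible advantage. \emph{The construction.}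 \begin{itemize} \item $\mathsf{Gen}$: sample coins $R_1$ of $\mathsf{OSS}.\mathsf{Setup}$, giving $\mathcal O$, and $\kappa$; set $\mathsf{dk}=(R_1,\kappa)$. $\mathsf{CK}$ consists of $\mathcal O$ and of $\mathsf{CK}_P(\mathsf{vk},x)=P(x)$, $\mathsf{CK}_{P^{-1}}(\mathsf{vk},y,u)=P^{-1}(y,u)$ and $\mathsf{CK}_D(\mathsf{vk},\sigma,y,u)=1-D(y,u)$ if $\mathsf{OSS}.\mathsf{Ver}^{\mathcal O}(\mathsf{vk},0,\sigma)$ accepts and $\bot$ otherwise, where $(P,P^{-1},D)$ are the $\overline{\mathsf{OSS}}$ oracles for the setup randomness $F_\kappa(\mathsf{vk})$. \item $\mathsf{Com}^{\mathsf{CK}}(b)$: run $(\mathsf{vk},|\mathsf{sk}\rangle)\leftarrow\mathsf{OSS}.\mathsf{Gen}^{\mathcal O}$; coherently sign $0$; run $\overline{\mathsf{OSS}}.\mathsf{Gen}$ with $\mathsf{CK}_P(\mathsf{vk},\cdot),\mathsf{CK}_{P^{-1}}(\mathsf{vk},\cdot,\cdot)$ to get $y$ and a $k$-qubit register $\mathcal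 U$; measure the first qubit of $\mathcal U$. If the outcome is not $b$, apply $H^{\otimes k}$ to $\mathcal U$, then the phase $(-1)^{\mathsf{CK}_D(\mathsf{vk},\sigma,y,u)}$ (trivial where $\mathsf{CK}_D$ is $\bot$) controlled on the signature register, then $H^{\otimes k}$ to $\mathcal U$. Undo the signing of $0$, sign $1$ to get $\sigma$, and output $c=(\mathsf{vk},\sigma,y)$ and $\mathcal U$. \item $\mathsf{OpenZ}$, $\mathsf{OpenX}$ measure all qubits of $(\mathcal B,\mathcal U)$ in the standard, respectively Hadamard, basis. \item $\mathsf{DecZ}$ and $\mathsf{DecX}$ on $c=(\mathsf{vk},\sigma,y)$ and opening $(b,u)$ output $\bot$ unless $\mathsf{OSS}.\mathsf{Ver}^{\mathcal O}(\mathsf{vk},1,\sigma)$ accepts. If it does, then, with $S_y$ defined from $F_\kappa(\mathsf{vk})$, $\mathsf{DecZ}$ outputs $b$ if $u\in S_{y,b}$ and $\bot$ otherwise; $\mathsf{DecX}$ outputs $b$ if $u\in S_y^\perp$, otherwise $b\oplus1$ if $u\oplus(1,0,\dots,0)\in S_y^\perp$, and otherwise $\bot$. \end{itemize} \textbf{Theorem.}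 (i) For every $\mathsf{OSS}$ and $F$ as in (1) and (3), the PFC constructed above is correct. (ii) For all $k,d$, $A\in\mathbb Z_2^{k\times d}$ and $v\in\mathbb Z_2^k$ such that $S_0$ and $S_1$ are both non-empty, and for all $b\in\{0,1\}$, \[H^{\otimes k}\,\mathsf{Phase}^{S^\perp}\,H^{\otimes k}\,|S_{1-b}\rangle=|S_b\rangle ,\] where $\mathsf{Phase}^{S^\perp}$ fixes $|s\rangle$ for $s\in S^\perp$ and maps $|s\rangle$ to $-|s\rangle$ for $s\notin S^\perp$. -/

import Mathlib

open scoped BigOperators Matrix Kronecker ComplexOrder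

noncomputable section

namespace PFC

/-! ### Bits, state vectors, negligible functions -/

/-- A bit. Addition in `ZMod 2` is exclusive or. -/
abbrev Bit : Type := ZMod 2

/-- Bit strings of length `n`, which are also the vectors of `(ZMod 2)^n` and the labels of the
computational basis of an `n`-qubit register. -/
abbrev Bits (n : ℕ) : Type := Fin n → Bit

/-- The first coordinate of a bit string (with value `0` for the empty string). -/
def firstBit {n : ℕ} (u : Bits n) : Bit := if h : 0 < n then u ⟨0, h⟩ else 0

/-- The string `(1, 0, ..., 0)`. -/
def unitFirst (n : ℕ) : Bits n := fun i => if i.val = 0 then 1 else 0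

/-- Negligible functions: those which decay faster than every inverse polynomial. -/
def Negligible (ε : ℕ → ℝ) : Prop :=
  Asymptotics.SuperpolynomialDecay Filter.atTop (fun lam : ℕ => (lam : ℝ)) ε

/-- Functions bounded by a polynomial. -/
def PolyBounded (f : ℕ → ℕ) : Prop :=
  ∃ p : Polynomial ℕ, ∀ lam, f lam ≤ p.eval lam

/-- The single-qubit Hadamard matrix. -/
def hadamard : Matrix Bit Bit ℂ :=
  Matrix.of fun a b => (((Real.sqrt 2)⁻¹ : ℝ) : ℂ) * (if a = 1 ∧ b = 1 then -1 else 1)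

/-- The `n`-fold tensor power of the Hadamard matrix. -/
def hadamardPow (n : ℕ) : Matrix (Bits n) (Bits n) ℂ :=
  Matrix.of fun u v => ∏ i, hadamard (u i) (v i)

/-- The uniform superposition over a finite set of basis vectors. -/
def uniformState {n : ℕ} (T : Finset (Bits n)) : Bits n → ℂ :=
  fun u => if u ∈ T then (((Real.sqrt (T.card : ℝ))⁻¹ : ℝ) : ℂ) else 0

/-- The phase oracle `|v⟩ ↦ (-1)^(f v) |v⟩`. -/
def phase {n : ℕ} (f : Bits n → Bit) (ψ : Bits n → ℂ) : Bits n → ℂ :=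
  fun v => (if f v = 1 then -1 else 1) * ψ v

/-- The total variation distance of two distributions on `{0, 1, ⊥}` (`⊥` is `none`). -/
def tvDist (p q : Option Bit → ℝ) : ℝ := (∑ a, |p a - q a|) / 2

/-- The outcome distribution of a standard basis measurement of a qubit with density matrix `ρ`. -/
def measZ (ρ : Matrix Bit Bit ℂ) : Option Bit → ℝ
  | some b => (ρ b b).re
  | none => 0

/-- The outcome distribution of a Hadamard basis measurement of a qubit. -/
def measX (ρ : Matrix Bit Bit ℂ) : Option Bit → ℝ :=
  measZ (hadamardᴴ * ρ * hadamard)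

/-- The rank one projector onto column `o` of `V`. For a unitary `V` these are the operators of the
measurement in the orthonormal basis formed by the columns of `V`. -/
def basisProj {ι : Type} (V : Matrix ι ι ℂ) (o : ι) : Matrix ι ι ℂ :=
  Matrix.vecMulVec (fun p => V p o) (star fun p => V p o)

/-! ### Pauli functional commitments -/

/-- A Pauli functional commitment at one value of the security parameter.

The quantum map `Com^CK(b)` is given by its Kraus operators: `Trace` lists the outcomes of all its
measurements (traced out registers count as measured), and `com ck t b` is the subnormalized state
of the register `U` on input `b` when the outcomes are `t`. The published string is part of the
outcomes. Openings are measurements (POVMs) on the qubit `B` together with `U`. -/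
structure PauliFunctionalCommitment where
  Coins : Type
  [coinsFintype : Fintype Coins]
  [coinsNonempty : Nonempty Coins]
  CommitKey : Type
  DecodeKey : Type
  keyGen : Coins → CommitKey × DecodeKey
  Trace : Type
  [traceFintype : Fintype Trace]
  ComString : Type
  comString : Trace → ComString
  uLen : ℕ
  com : CommitKey → Trace → Bit → (Bits uLen → ℂ)
  com_norm : ∀ ck b, ∑ t, ∑ u, ‖com ck t b u‖ ^ 2 = 1
  Opening : Type
  [openingFintype : Fintype Opening]
  openZ : Opening → Matrix (Bit × Bits uLen) (Bit × Bits uLen) ℂ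
  openX : Opening → Matrix (Bit × Bits uLen) (Bit × Bits uLen) ℂ
  openZ_pos : ∀ o, (openZ o).PosSemidef
  openX_pos : ∀ o, (openX o).PosSemidef
  openZ_sum : ∑ o, openZ o = 1
  openX_sum : ∑ o, openX o = 1
  decZ : DecodeKey → ComString → Opening → Option Bit
  decX : DecodeKey → ComString → Opening → Option Bit

attribute [instance] PauliFunctionalCommitment.coinsFintype
  PauliFunctionalCommitment.coinsNonempty PauliFunctionalCommitment.traceFintype
  PauliFunctionalCommitment.openingFintype

namespace PauliFunctionalCommitment

variable (pfc : PauliFunctionalCommitment)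

/-- The subnormalized state on `(B, U)` after `Com^CK`, controlled by the qubit `B` in state `ρ`,
has produced the outcomes `t`: the Kraus operator is
`|0⟩⟨0| ⊗ com ck t 0 + |1⟩⟨1| ⊗ com ck t 1`. -/
def committed (ck : pfc.CommitKey) (ρ : Matrix Bit Bit ℂ) (t : pfc.Trace) :
    Matrix (Bit × Bits pfc.uLen) (Bit × Bits pfc.uLen) ℂ :=
  Matrix.of fun p q => pfc.com ck t p.1 p.2 * ρ p.1 q.1 * star (pfc.com ck t q.1 q.2)

/-- The distribution of the output when `ρ` is committed, opened by the measurement `opn` and decoded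
by `dec`, for freshly generated keys. -/
def experiment (opn : pfc.Opening → Matrix (Bit × Bits pfc.uLen) (Bit × Bits pfc.uLen) ℂ)
    (dec : pfc.DecodeKey → pfc.ComString → pfc.Opening → Option Bit)
    (ρ : Matrix Bit Bit ℂ) (a : Option Bit) : ℝ :=
  𝔼 R : pfc.Coins, ∑ t, ∑ o,
    if dec (pfc.keyGen R).2 (pfc.comString t) o = a
    then (opn o * pfc.committed (pfc.keyGen R).1 ρ t).trace.re else 0

/-- Commit, open and decode in the standard basis. -/
def pfcZ : Matrix Bit Bit ℂ → Option Bit → ℝ := pfc.experiment pfc.openZ pfc.decZ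

/-- Commit, open and decode in the Hadamard basis. -/
def pfcX : Matrix Bit Bit ℂ → Option Bit → ℝ := pfc.experiment pfc.openX pfc.decX

/-- Correctness of a scheme (a Pauli functional commitment for every security parameter). -/
def Correct (pfc : ℕ → PauliFunctionalCommitment) : Prop :=
  ∃ ε : ℕ → ℝ, Negligible ε ∧
    ∀ (lam : ℕ) (ρ : Matrix Bit Bit ℂ), ρ.PosSemidef → ρ.trace = 1 →
      tvDist (measZ ρ) ((pfc lam).pfcZ ρ) ≤ ε lam ∧
      tvDist (measX ρ) ((pfc lam).pfcX ρ) ≤ ε lam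

end PauliFunctionalCommitment

/-! ### One-shot signatures -/

/-- The algorithms of a one-shot signature scheme for one-bit messages, at one value of the security
parameter.

* `setup` maps its random coins to a classical oracle.
* `gen O vk a` is the subnormalized secret key state when key generation with oracle `O` outputs `vk`
  and all its other measurements (and discarded registers) give `a`; its squared norm is the
  probability of `(vk, a)`. The state lives on the signature register and the work register of the
  signer, and contains the zero-initialized ancillas.
* Signing `m` applies the unitary `sign O m` and then measures the signature register. -/
structure OneShotSignature where
  Coins : Type
  [coinsFintype : Fintype Coins]
  [coinsNonempty : Nonempty Coins]
  inLen : ℕ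
  outLen : ℕ
  setup : Coins → (Bits inLen → Bits outLen)
  vkLen : ℕ
  auxLen : ℕ
  sigLen : ℕ
  workLen : ℕ
  gen : (Bits inLen → Bits outLen) → Bits vkLen → Bits auxLen → (Bits sigLen × Bits workLen → ℂ)
  gen_norm : ∀ O, ∑ vk, ∑ a, ∑ z, ‖gen O vk a z‖ ^ 2 = 1
  sign : (Bits inLen → Bits outLen) → Bit →
    Matrix.unitaryGroup (Bits sigLen × Bits workLen) ℂ
  ver : (Bits inLen → Bits outLen) → Bits vkLen → Bit → Bits sigLen → Bool

attribute [instance] OneShotSignature.coinsFintype OneShotSignature.coinsNonempty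

namespace OneShotSignature

/-- The type of the classical oracles of the scheme. -/
abbrev Oracle (oss : OneShotSignature) : Type := Bits oss.inLen → Bits oss.outLen

/-- The labels of the basis of the signer's register (signature register and work register). -/
abbrev Reg (oss : OneShotSignature) : Type := Bits oss.sigLen × Bits oss.workLen

/-- The probability that an honestly generated signature of the bit `m` is accepted. -/
def acceptProb (oss : OneShotSignature) (m : Bit) : ℝ :=
  𝔼 R : oss.Coins, ∑ vk, ∑ a, ∑ z : oss.Reg,
    if oss.ver (oss.setup R) vk m z.1 = true
    then ‖((oss.sign (oss.setup R) m : Matrix oss.Reg oss.Reg ℂ) *ᵥ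
      oss.gen (oss.setup R) vk a) z‖ ^ 2
    else 0

/-- Correctness of a one-shot signature scheme. -/
def Correct (oss : ℕ → OneShotSignature) : Prop :=
  ∀ m : Bit, Negligible fun lam => 1 - (oss lam).acceptProb m

end OneShotSignature

/-! ### The coset-based one-shot signature scheme

Here `r` is the bit length of the verification keys `y`, `d` is the dimension of the cosets `S_y`,
`k` is the dimension of the ambient space, and inputs have `n = r + d` bits. -/

/-- The matrices of full column rank. -/
abbrev FullRank (k d : ℕ) : Type := {A : Matrix (Fin k) (Fin d) Bit // A.rank = d}

/-- The randomness of the setup algorithm: a permutation `Π` of `{0,1}^n` and a function `F` which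
maps `y` to a pair `(A_y, b_y)`. -/
abbrev CosetCoins (r d k : ℕ) : Type :=
  Equiv.Perm (Bits (r + d)) × (Bits r → FullRank k d × Bits k)

instance (r d k : ℕ) : Fintype (CosetCoins r d k) := Fintype.ofFinite _

/-- The affine subspace `{A x + b}`. -/
def coset {k d : ℕ} (A : Matrix (Fin k) (Fin d) Bit) (b : Bits k) : Set (Bits k) :=
  {u | ∃ x : Bits d, A *ᵥ x + b = u}

open Classical in
/-- The elements of the affine subspace `{A x + b}` whose first coordinate is `c`. -/
def cosetHalf {k d : ℕ} (A : Matrix (Fin k) (Fin d) Bit) (b : Bits k) (c : Bit) :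
    Finset (Bits k) :=
  Finset.univ.filter fun u => u ∈ coset A b ∧ firstBit u = c

/-- The vectors orthogonal to all columns of `A`. -/
def dual {k d : ℕ} (A : Matrix (Fin k) (Fin d) Bit) : Set (Bits k) :=
  {v | v ᵥ* A = 0}

namespace CosetCoins

variable {r d k : ℕ}

/-- The matrix `A_y`. -/
def mat (ω : CosetCoins r d k) (y : Bits r) : Matrix (Fin k) (Fin d) Bit := (ω.2 y).1.1

/-- The vector `b_y`. -/
def vec (ω : CosetCoins r d k) (y : Bits r) : Bits k := (ω.2 y).2

/-- The first `r` bits of `Π x`. -/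
def hashH (ω : CosetCoins r d k) (x : Bits (r + d)) : Bits r :=
  fun i => ω.1 x (Fin.castAdd d i)

/-- The remaining bits of `Π x`. -/
def hashJ (ω : CosetCoins r d k) (x : Bits (r + d)) : Bits d :=
  fun j => ω.1 x (Fin.natAdd r j)

/-- The oracle `P`. -/
def oracleP (ω : CosetCoins r d k) (x : Bits (r + d)) : Bits r × Bits k :=
  (ω.hashH x, ω.mat (ω.hashH x) *ᵥ ω.hashJ x + ω.vec (ω.hashH x))

open Classical in
/-- The oracle `P⁻¹` (`none` stands for `⊥`). -/
def oraclePinv (ω : CosetCoins r d k) (y : Bits r) (u : Bits k) : Option (Bits (r + d)) :=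
  if h : ∃ z : Bits d, ω.mat y *ᵥ z + ω.vec y = u then some (ω.1.symm (Fin.append y h.choose))
  else none

open Classical in
/-- The oracle `D`. -/
def oracleD (ω : CosetCoins r d k) (y : Bits r) (v : Bits k) : Bit :=
  if v ∈ dual (ω.mat y) then 1 else 0

end CosetCoins

/-- The state of the registers `(X, Y, U)` at the start of key generation: the uniform superposition
on `X`, zeros on `Y` and `U`. -/
def cosetInit (r d k : ℕ) (_x : Bits (r + d)) (y : Bits r) (u : Bits k) : ℂ :=
  if y = 0 ∧ u = 0 then (((Real.sqrt 2)⁻¹ : ℝ) : ℂ) ^ (r + d) else 0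

/-- Key generation of the coset-based scheme, with oracles `P` and `Pinv`: prepare the uniform
superposition over `x`, apply `|x, y, u⟩ ↦ |x, (y, u) ⊕ P x⟩`, measure `Y`, and uncompute `X` by
`|x, y, u⟩ ↦ |x ⊕ Pinv (y, u), y, u⟩` (identity where `Pinv` returns `⊥`). This is the subnormalized
state on `U` for the outcome `y`, when the register `X`, which is discarded, is found to hold `x`. -/
def cosetGen {r d k : ℕ} (P : Bits (r + d) → Bits r × Bits k)
    (Pinv : Bits r → Bits k → Option (Bits (r + d))) (y : Bits r) (x : Bits (r + d)) :
    Bits k → ℂ :=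
  fun u =>
    let x' := x - (Pinv y u).getD 0
    cosetInit r d k x' (y - (P x').1) (u - (P x').2)

/-! ### Pseudorandom functions -/

/-- A keyed function from `v`-bit strings to `R`. -/
structure KeyedFunction (v : ℕ) (R : Type) where
  Key : Type
  [keyFintype : Fintype Key]
  [keyNonempty : Nonempty Key]
  eval : Key → Bits v → R

attribute [instance] KeyedFunction.keyFintype KeyedFunction.keyNonempty

/-- The gates of Boolean circuits with access to an oracle `f` from `v`-bit strings to setup
randomness `(Π, F)`. As the value of `f` is an exponentially long table, it is read bit by bit.
Each gate appends one bit to the list of wires and refers to earlier wires by their position. -/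
inductive Gate (v r d k : ℕ) : Type
  /-- a constant -/
  | const (c : Bit)
  /-- an arbitrary gate of fan-in two -/
  | op (g : Bit → Bit → Bit) (i j : ℕ)
  /-- bit `l` of `Π x`, for `(Π, F) = f vk` -/
  | perm (vk : Fin v → ℕ) (x : Fin (r + d) → ℕ) (l : Fin (r + d))
  /-- entry `(i, j)` of `A_y`, for `(Π, F) = f vk` -/
  | mat (vk : Fin v → ℕ) (y : Fin r → ℕ) (i : Fin k) (j : Fin d)
  /-- entry `i` of `b_y`, for `(Π, F) = f vk` -/
  | vec (vk : Fin v → ℕ) (y : Fin r → ℕ) (i : Fin k)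

namespace Gate

variable {v r d k : ℕ}

/-- The number of wires that a gate touches. -/
def size : Gate v r d k → ℕ
  | const _ => 1
  | op _ _ _ => 3
  | perm _ _ _ => v + (r + d) + 1
  | mat _ _ _ _ => v + r + 1
  | vec _ _ _ => v + r + 1

/-- The output bit of a gate, given the oracle and the bits on the earlier wires. -/
def value (f : Bits v → CosetCoins r d k) (w : List Bit) : Gate v r d k → Bit
  | const c => c
  | op g i j => g (w.getD i 0) (w.getD j 0)
  | perm vk x l => (f fun a => w.getD (vk a) 0).1 (fun a => w.getD (x a) 0) l
  | mat vk y i j => (f fun a => w.getD (vk a) 0).mat (fun a => w.getD (y a) 0) i j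
  | vec vk y i => (f fun a => w.getD (vk a) 0).vec (fun a => w.getD (y a) 0) i

end Gate

/-- Oracle circuits, as lists of gates in the order of evaluation. -/
abbrev Circuit (v r d k : ℕ) : Type := List (Gate v r d k)

namespace Circuit

variable {v r d k : ℕ}

/-- The size of a circuit. -/
def size (C : Circuit v r d k) : ℕ := (C.map Gate.size).sum

/-- The bits on all wires. -/
def wires (C : Circuit v r d k) (f : Bits v → CosetCoins r d k) : List Bit :=
  C.foldl (fun w g => w ++ [g.value f w]) []

/-- The output of a circuit: `1` if the last wire carries the bit `1`, and `0` otherwise. -/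
def output (C : Circuit v r d k) (f : Bits v → CosetCoins r d k) : ℝ :=
  if (C.wires f).getLast? = some 1 then 1 else 0

end Circuit

/-- Security of a pseudorandom function whose values are setup randomness `(Π, F)`: no family of
polynomial size oracle circuits distinguishes the function with a random key from a uniformly random
function. (Security against quantum distinguishers with superposition queries implies this.) -/
def Pseudorandom {v r d k : ℕ → ℕ}
    (prf : ∀ lam, KeyedFunction (v lam) (CosetCoins (r lam) (d lam) (k lam))) : Prop :=
  ∀ C : ∀ lam, Circuit (v lam) (r lam) (d lam) (k lam),
    PolyBounded (fun lam => (C lam).size) →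
    Negligible fun lam =>
      |(𝔼 key : (prf lam).Key, (C lam).output ((prf lam).eval key)) -
        𝔼 f : Bits (v lam) → CosetCoins (r lam) (d lam) (k lam), (C lam).output f|

/-! ### The construction -/

/-- `r = s (λ - 1)` for `s = 16 λ`. -/
def rParam (lam : ℕ) : ℕ := 16 * lam * (lam - 1)

/-- `n - r = 3 s / 2` for `s = 16 λ`. -/
def dParam (lam : ℕ) : ℕ := 24 * lam

/-- `n`, which is also the ambient dimension `k`. -/
def nParam (lam : ℕ) : ℕ := rParam lam + dParam lam

/-- The classical oracles that make up a commitment key. The oracle `D` returns `none` for `⊥`. -/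
structure CommitOracles (oss : OneShotSignature) (r d k : ℕ) where
  O : oss.Oracle
  P : Bits oss.vkLen → Bits (r + d) → Bits r × Bits k
  Pinv : Bits oss.vkLen → Bits r → Bits k → Option (Bits (r + d))
  D : Bits oss.vkLen → Bits oss.sigLen → Bits r → Bits k → Option Bit

section Construction

variable (oss : OneShotSignature) {r d k : ℕ}

/-- The commitment key for the oracle `O`, where `f vk` is the setup randomness of the coset-based
scheme used with `vk`. -/
def commitOracles (O : oss.Oracle) (f : Bits oss.vkLen → CosetCoins r d k) :
    CommitOracles oss r d k where
  O := O
  P := fun vk x => (f vk).oracleP x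
  Pinv := fun vk y u => (f vk).oraclePinv y u
  D := fun vk σ y u =>
    if oss.ver O vk 0 σ = true then some (1 - (f vk).oracleD y u) else none

/-- The classical outcomes of a run of `Com`: key generation of the one-shot signature gives `vk` and
further outcomes, the coset-based key generation leaves `x` in its discarded register and outputs `y`,
the first qubit of `U` is measured, and the signer's register is measured (signature register) or
discarded (work register). -/
abbrev CommitTrace (oss : OneShotSignature) (r d : ℕ) : Type :=
  (Bits oss.vkLen × Bits oss.auxLen) × (Bits (r + d) × Bits r) × Bit × oss.Reg

variable {oss}

/-- Apply a matrix to the signer's register. -/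
def onReg (V : Matrix oss.Reg oss.Reg ℂ) (Φ : oss.Reg → Bits k → ℂ) : oss.Reg → Bits k → ℂ :=
  fun z u => ∑ z', V z z' * Φ z' u

/-- The operation `(H^{⊗k} ⊗ I) Phase (H^{⊗k} ⊗ I)`, where `Phase` multiplies `|u⟩|σ⟩` by
`(-1)^(D(σ, u))` (by `1` where `D` returns `⊥`). -/
def rotate (D : Bits oss.sigLen → Bits k → Option Bit) (Φ : oss.Reg → Bits k → ℂ) :
    oss.Reg → Bits k → ℂ :=
  fun z => hadamardPow k *ᵥ phase (fun u => (D z.1 u).getD 0) (hadamardPow k *ᵥ Φ z)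

/-- The projection onto first bit `c` in the register `U`. -/
def collapse (c : Bit) (Φ : oss.Reg → Bits k → ℂ) : oss.Reg → Bits k → ℂ :=
  fun z u => if firstBit u = c then Φ z u else 0

/-- The subnormalized final state on `U` in a run of `Com` on the bit `b`. -/
def commitState (ck : CommitOracles oss r d k) (t : CommitTrace oss r d) (b : Bit) :
    Bits k → ℂ :=
  let vk := t.1.1
  let x := t.2.1.1
  let y := t.2.1.2
  let b' := t.2.2.1
  let V (m : Bit) : Matrix oss.Reg oss.Reg ℂ := oss.sign ck.O m
  -- generate the one-shot signature key, coherently sign `0`, generate the coset state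
  let Φ₀ : oss.Reg → Bits k → ℂ := fun z u =>
    (V 0 *ᵥ oss.gen ck.O vk t.1.2) z * cosetGen (ck.P vk) (ck.Pinv vk) y x u
  -- measure the first qubit of `U`
  let Φ₁ := collapse b' Φ₀
  -- rotate if the outcome is not `b`
  let Φ₂ := if b' = b then Φ₁ else rotate (fun σ u => ck.D vk σ y u) Φ₁
  -- reverse the signature of `0`, then sign `1`
  let Φ₃ := onReg (V 1) (onReg (V 0)ᴴ Φ₂)
  Φ₃ t.2.2.2

/-! Facts needed to see that the construction is a commitment: `Com` preserves norms and the openings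
are measurements. -/

lemma hadamard_conjTranspose : hadamardᴴ = hadamard := by
  ext a b
  rw [Matrix.conjTranspose_apply]
  simp only [hadamard, Matrix.of_apply, and_comm (a := b = 1)]
  split_ifs <;> simp

lemma hadamard_mul_self : hadamard * hadamard = 1 := by
  have h2 : (((Real.sqrt 2)⁻¹ : ℝ) : ℂ) * (((Real.sqrt 2)⁻¹ : ℝ) : ℂ) = 1 / 2 := by
    rw [← Complex.ofReal_mul, ← mul_inv, Real.mul_self_sqrt (by norm_num)]
    norm_num
  generalize hs : (((Real.sqrt 2)⁻¹ : ℝ) : ℂ) = s at h2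
  ext a b
  rw [Matrix.mul_apply, Matrix.one_apply,
    show (Finset.univ : Finset Bit) = {0, 1} from rfl, Finset.sum_pair (by decide)]
  have hbit : ∀ c : Bit, c = 0 ∨ c = 1 := by decide
  simp only [hadamard, Matrix.of_apply, hs]
  rcases hbit a with rfl | rfl <;> rcases hbit b with rfl | rfl <;>
    simp [h2] <;> norm_num

lemma hadamardPow_conjTranspose (n : ℕ) : (hadamardPow n)ᴴ = hadamardPow n := by
  ext u v
  simp only [hadamardPow, Matrix.conjTranspose_apply, Matrix.of_apply, star_prod]
  refine Finset.prod_congr rfl fun i _ => ?_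
  rw [← Matrix.conjTranspose_apply, hadamard_conjTranspose]

lemma hadamardPow_mul_self (n : ℕ) : hadamardPow n * hadamardPow n = 1 := by
  ext u w
  simp only [hadamardPow, Matrix.mul_apply, Matrix.of_apply, ← Finset.prod_mul_distrib]
  have h := (Finset.prod_univ_sum (fun _ : Fin n => (Finset.univ : Finset Bit))
    (fun i c => hadamard (u i) c * hadamard c (w i)))
  rw [Fintype.piFinset_univ] at h
  rw [← h]
  have h' : ∀ i, ∑ c, hadamard (u i) c * hadamard c (w i) = if u i = w i then 1 else 0 := by
    intro i
    rw [← Matrix.mul_apply, hadamard_mul_self, Matrix.one_apply]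
  simp only [h', Matrix.one_apply]
  by_cases huw : u = w
  · simp [huw]
  · rw [if_neg huw]
    obtain ⟨i, hi⟩ := Function.ne_iff.mp huw
    exact Finset.prod_eq_zero (Finset.mem_univ i) (if_neg hi)

/-- The Hadamard transform of the qubit `B` together with a `k`-qubit register. -/
def hadamardAll (k : ℕ) : Matrix (Bit × Bits k) (Bit × Bits k) ℂ := hadamard ⊗ₖ hadamardPow k

lemma hadamardAll_mul_conjTranspose (k : ℕ) : hadamardAll k * (hadamardAll k)ᴴ = 1 := by
  rw [hadamardAll, Matrix.conjTranspose_kronecker, hadamard_conjTranspose,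
    hadamardPow_conjTranspose, ← Matrix.mul_kronecker_mul, hadamard_mul_self,
    hadamardPow_mul_self, Matrix.one_kronecker_one]

lemma basisProj_posSemidef {ι : Type} [Fintype ι] (V : Matrix ι ι ℂ) (o : ι) : (basisProj V o).PosSemidef :=
  Matrix.posSemidef_vecMulVec_self_star _

lemma basisProj_sum {ι : Type} [Fintype ι] [DecidableEq ι] (V : Matrix ι ι ℂ)
    (hV : V * Vᴴ = 1) : ∑ o, basisProj V o = 1 := by
  rw [← hV]
  ext p q
  simp [basisProj, Matrix.sum_apply, Matrix.mul_apply, Matrix.vecMulVec_apply]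

lemma sum_norm_sq_mulVec {ι : Type} [Fintype ι] [DecidableEq ι] (V : Matrix ι ι ℂ)
    (hV : Vᴴ * V = 1) (ψ : ι → ℂ) : ∑ i, ‖(V *ᵥ ψ) i‖ ^ 2 = ∑ i, ‖ψ i‖ ^ 2 := by
  have key : ∀ φ : ι → ℂ, ((∑ i, ‖φ i‖ ^ 2 : ℝ) : ℂ) = star φ ⬝ᵥ φ := by
    intro φ
    simp only [dotProduct, Pi.star_apply, Complex.ofReal_sum, Complex.ofReal_pow]
    refine Finset.sum_congr rfl fun i _ => ?_
    rw [Complex.star_def, Complex.conj_mul']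
  apply Complex.ofReal_injective
  rw [key, key, Matrix.star_mulVec, Matrix.dotProduct_mulVec, Matrix.vecMul_vecMul, hV,
    Matrix.vecMul_one]

lemma onReg_norm (V : Matrix oss.Reg oss.Reg ℂ) (hV : Vᴴ * V = 1) (Φ : oss.Reg → Bits k → ℂ) :
    ∑ z, ∑ u, ‖onReg V Φ z u‖ ^ 2 = ∑ z, ∑ u, ‖Φ z u‖ ^ 2 := by
  rw [Finset.sum_comm, Finset.sum_comm (f := fun z u => ‖Φ z u‖ ^ 2)]
  refine Finset.sum_congr rfl fun u _ => ?_
  exact sum_norm_sq_mulVec V hV fun z => Φ z u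

lemma rotate_norm (D : Bits oss.sigLen → Bits k → Option Bit) (Φ : oss.Reg → Bits k → ℂ) :
    ∑ z, ∑ u, ‖rotate D Φ z u‖ ^ 2 = ∑ z, ∑ u, ‖Φ z u‖ ^ 2 := by
  have hH : (hadamardPow k)ᴴ * hadamardPow k = 1 := by
    rw [hadamardPow_conjTranspose, hadamardPow_mul_self]
  refine Finset.sum_congr rfl fun z _ => ?_
  rw [← sum_norm_sq_mulVec _ hH (Φ z)]
  simp only [rotate]
  rw [sum_norm_sq_mulVec _ hH]
  refine Finset.sum_congr rfl fun u _ => ?_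
  simp only [phase, norm_mul]
  split_ifs <;> simp

lemma collapse_norm (Φ : oss.Reg → Bits k → ℂ) :
    ∑ c, ∑ z, ∑ u, ‖collapse c Φ z u‖ ^ 2 = ∑ z, ∑ u, ‖Φ z u‖ ^ 2 := by
  rw [Finset.sum_comm]
  refine Finset.sum_congr rfl fun z _ => ?_
  rw [Finset.sum_comm]
  refine Finset.sum_congr rfl fun u _ => ?_
  rw [Finset.sum_eq_single (firstBit u)]
  · simp [collapse]
  · intro c _ hc
    simp [collapse, hc.symm]
  · simp

lemma cosetGen_norm (P : Bits (r + d) → Bits r × Bits k)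
    (Pinv : Bits r → Bits k → Option (Bits (r + d))) :
    ∑ p : Bits (r + d) × Bits r, ∑ u, ‖cosetGen P Pinv p.2 p.1 u‖ ^ 2 = 1 := by
  have h1 : ∀ (y : Bits r) (u : Bits k), ∑ x, ‖cosetGen P Pinv y x u‖ ^ 2 =
      ∑ x, ‖cosetInit r d k x (y - (P x).1) (u - (P x).2)‖ ^ 2 := fun y u =>
    Equiv.sum_comp (Equiv.subRight ((Pinv y u).getD 0))
      fun x => ‖cosetInit r d k x (y - (P x).1) (u - (P x).2)‖ ^ 2
  have h2 : ∀ x : Bits (r + d),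
      ∑ y, ∑ u, ‖cosetInit r d k x (y - (P x).1) (u - (P x).2)‖ ^ 2 = (1 / 2) ^ (r + d) := by
    intro x
    rw [Finset.sum_eq_single (P x).1, Finset.sum_eq_single (P x).2]
    · simp only [cosetInit, sub_self, and_self, if_true, norm_pow, Complex.norm_real]
      rw [← pow_mul, mul_comm (r + d) 2, pow_mul, Real.norm_eq_abs, sq_abs, inv_pow,
        Real.sq_sqrt (by norm_num), one_div]
    · intro u _ hu
      simp [cosetInit, sub_eq_zero, hu]
    · simp
    · intro y _ hy
      simp [cosetInit, sub_eq_zero, hy]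
    · simp
  rw [Fintype.sum_prod_type, Finset.sum_comm]
  have h3 : ∀ y : Bits r, ∑ x, ∑ u, ‖cosetGen P Pinv y x u‖ ^ 2 =
      ∑ x, ∑ u, ‖cosetInit r d k x (y - (P x).1) (u - (P x).2)‖ ^ 2 := by
    intro y
    rw [Finset.sum_comm, Finset.sum_comm (s := (Finset.univ : Finset (Bits (r + d))))]
    exact Finset.sum_congr rfl fun u _ => h1 y u
  simp only [h3]
  rw [Finset.sum_comm]
  simp only [h2]
  simp

lemma commitState_norm (ck : CommitOracles oss r d k) (b : Bit) :
    ∑ t, ∑ u, ‖commitState ck t b u‖ ^ 2 = 1 := by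
  have hU : ∀ m, (oss.sign ck.O m : Matrix oss.Reg oss.Reg ℂ)ᴴ * oss.sign ck.O m = 1 := fun m =>
    Matrix.mem_unitaryGroup_iff'.mp (oss.sign ck.O m).2
  have hU' : ∀ m, (oss.sign ck.O m : Matrix oss.Reg oss.Reg ℂ)ᴴᴴ *
      (oss.sign ck.O m : Matrix oss.Reg oss.Reg ℂ)ᴴ = 1 := fun m => by
    rw [Matrix.conjTranspose_conjTranspose]
    exact Matrix.mem_unitaryGroup_iff.mp (oss.sign ck.O m).2
  have step : ∀ (a : Bits oss.vkLen × Bits oss.auxLen) (p : Bits (r + d) × Bits r),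
      ∑ q : Bit × oss.Reg, ∑ u, ‖commitState ck (a, p, q) b u‖ ^ 2 =
      (∑ z, ‖oss.gen ck.O a.1 a.2 z‖ ^ 2) *
        ∑ u, ‖cosetGen (ck.P a.1) (ck.Pinv a.1) p.2 p.1 u‖ ^ 2 := by
    intro a p
    rw [Fintype.sum_prod_type, ← sum_norm_sq_mulVec _ (hU 0), Finset.sum_mul_sum]
    simp only [← mul_pow, ← norm_mul]
    rw [← collapse_norm]
    refine Finset.sum_congr rfl fun c _ => ?_
    simp only [commitState]
    rw [onReg_norm _ (hU 1), onReg_norm _ (hU' 0)]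
    split_ifs
    · rfl
    · exact rotate_norm _ _
  have split : ∀ a : Bits oss.vkLen × Bits oss.auxLen,
      ∑ s : (Bits (r + d) × Bits r) × (Bit × oss.Reg), ∑ u, ‖commitState ck (a, s) b u‖ ^ 2 =
      ∑ p, ∑ q, ∑ u, ‖commitState ck (a, p, q) b u‖ ^ 2 := fun a => Fintype.sum_prod_type _
  rw [Fintype.sum_prod_type]
  simp only [split, step]
  simp only [← Finset.mul_sum, cosetGen_norm, mul_one]
  rw [Fintype.sum_prod_type]
  exact oss.gen_norm ck.O

variable (oss)

open Classical in
/-- The Pauli functional commitment built from a one-shot signature scheme, the coset-based one-shot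
signature scheme with parameters `r`, `d`, `k`, and a keyed function with values in the setup
randomness of the latter. Commitment strings are triples `(vk, σ, y)`, openings are pairs `(b, u)`. -/
def construction (prf : KeyedFunction oss.vkLen (CosetCoins r d k)) :
    PauliFunctionalCommitment where
  Coins := oss.Coins × prf.Key
  CommitKey := CommitOracles oss r d k
  DecodeKey := oss.Coins × prf.Key
  keyGen := fun R => (commitOracles oss (oss.setup R.1) (prf.eval R.2), R)
  Trace := CommitTrace oss r d
  ComString := Bits oss.vkLen × Bits oss.sigLen × Bits r
  comString := fun t => (t.1.1, t.2.2.2.1, t.2.1.2)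
  uLen := k
  com := commitState
  com_norm := commitState_norm
  Opening := Bit × Bits k
  openZ := basisProj 1
  openX := basisProj (hadamardAll k)
  openZ_pos := basisProj_posSemidef _
  openX_pos := basisProj_posSemidef _
  openZ_sum := basisProj_sum _ (by simp)
  openX_sum := basisProj_sum _ (hadamardAll_mul_conjTranspose k)
  decZ := fun dk c o =>
    let ω := prf.eval dk.2 c.1
    let y := c.2.2
    if oss.ver (oss.setup dk.1) c.1 1 c.2.1 = true then
      if o.2 ∈ cosetHalf (ω.mat y) (ω.vec y) o.1 then some o.1 else none
    else none
  decX := fun dk c o =>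
    let ω := prf.eval dk.2 c.1
    let y := c.2.2
    if oss.ver (oss.setup dk.1) c.1 1 c.2.1 = true then
      if o.2 ∈ dual (ω.mat y) then some o.1
      else if o.2 + unitFirst k ∈ dual (ω.mat y) then some (o.1 + 1)
      else none
    else none

end Construction

/-- The construction for every security parameter. -/
def scheme (oss : ℕ → OneShotSignature)
    (prf : ∀ lam, KeyedFunction (oss lam).vkLen
      (CosetCoins (rParam lam) (dParam lam) (nParam lam))) :
    ℕ → PauliFunctionalCommitment :=
  fun lam => construction (oss lam) (prf lam)

end PFC

end

noncomputable section

namespace PFC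

/-! ### Signs and the Hadamard transform -/

/-! Both claims rest on one Fourier computation. Write `F` for the Hadamard transform of the
indicator of `S`, and `e` for `unitFirst k`. The indicator of `S_c` is `(1/2)(1 + (-1)^c
(-1)^(u_1))` times that of `S`, and multiplying by `(-1)^(u_1)` before the transform shifts
frequencies by `e`, so it transforms to `(1/2)(F(s) + (-1)^c F(s + e))`. Translation invariance of
`S` puts the support of `F` inside the dual. If both halves are non-empty, then `e` is not in the
dual, so the two terms live on the disjoint sets `S^⊥` and `S^⊥ + e`. A sign off `S^⊥` negates
exactly the second term and exchanges `c` with `1 - c` (`rotate_halfInd`). Unitarity then makes the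
halves equally large, which gives the statement about normalized states.

For correctness, the unnormalized ideal commitment to `∑ β_b |b⟩` is `∑ β_b |b⟩|S_b⟩`. The same
disjointness shows that both decoders reproduce the measurement of `β` exactly (`decodesTo_Z`,
`decodesTo_X`). A real run (`commitState_honest`) differs in three ways. Failure to sign `0`
perturbs the amplitudes; by Cauchy–Schwarz and Jensen this costs the square root of the failure
probability. Failure to sign `1` turns the output into `⊥`; this costs the failure probability
itself. Finally, a half of `S_y` may be empty (`badInd`). The outcome `y` is uniform and the law of
`vk` depends only on the signature oracle, so neither is correlated with the key `κ`. It therefore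
suffices to bound the probability over `κ` at the worst fixed pair `(vk, y)`. An empty half forces
the first row of `A_y` to vanish, which a small classical circuit with that pair hardwired detects;
for a uniformly random function this has probability at most `2 / 2^d` (`expect_rowInd_le`).

These bounds are proved for pure states (`avgDist_bound`) and extended to mixed states by linearity
(`tvDist_experiment_le`). -/

/-- The sign `(-1)^a`. -/
def sgn (a : Bit) : ℂ := if a = 1 then -1 else 1

lemma bit_cases (a : Bit) : a = 0 ∨ a = 1 := by revert a; decide

@[simp] lemma sgn_zero : sgn 0 = 1 := by simp [sgn]

@[simp] lemma sgn_one : sgn 1 = -1 := by simp [sgn]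

lemma sgn_add (a b : Bit) : sgn (a + b) = sgn a * sgn b := by
  rcases bit_cases a with rfl | rfl <;> rcases bit_cases b with rfl | rfl <;>
    simp [show (1 + 1 : Bit) = 0 from rfl]

lemma sgn_sum {ι : Type*} (s : Finset ι) (f : ι → Bit) :
    sgn (∑ i ∈ s, f i) = ∏ i ∈ s, sgn (f i) := by
  classical
  induction s using Finset.induction_on with
  | empty => simp
  | insert a s ha ih => rw [Finset.sum_insert ha, Finset.prod_insert ha, sgn_add, ih]

/-- The complex number `1 / √2`. -/
def invSqrtTwo : ℂ := (((Real.sqrt 2)⁻¹ : ℝ) : ℂ)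

lemma invSqrtTwo_norm_sq : ‖invSqrtTwo‖ ^ 2 = 1 / 2 := by
  rw [invSqrtTwo, Complex.norm_real, Real.norm_eq_abs, sq_abs, inv_pow,
    Real.sq_sqrt (by norm_num), one_div]

lemma hadamard_apply (a b : Bit) : hadamard a b = invSqrtTwo * sgn (a * b) := by
  rcases bit_cases a with rfl | rfl <;> rcases bit_cases b with rfl | rfl <;>
    simp [hadamard, invSqrtTwo]

lemma hadamardPow_apply {n : ℕ} (u v : Bits n) :
    hadamardPow n u v = invSqrtTwo ^ n * sgn (u ⬝ᵥ v) := by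
  simp only [hadamardPow, Matrix.of_apply, hadamard_apply, Finset.prod_mul_distrib, dotProduct,
    sgn_sum, Finset.prod_const, Finset.card_univ, Fintype.card_fin]

/-- Makes `(-1)^(u_1)` a character, so that multiplying by it becomes a shift by `unitFirst` on the
Fourier side. -/
lemma firstBit_eq {n : ℕ} (u : Bits n) : firstBit u = unitFirst n ⬝ᵥ u := by
  unfold firstBit unitFirst dotProduct
  split_ifs with h
  · rw [Finset.sum_eq_single (⟨0, h⟩ : Fin n)]
    · simp
    · intro i _ hi
      have : i.val ≠ 0 := fun h' => hi (Fin.ext h')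
      simp [this]
    · simp
  · obtain rfl : n = 0 := by omega
    simp

lemma firstBit_add {n : ℕ} (u w : Bits n) : firstBit (u + w) = firstBit u + firstBit w := by
  simp only [firstBit_eq, dotProduct_add]

lemma bits_add_self {n : ℕ} (u : Bits n) : u + u = 0 := by
  ext i
  exact CharTwo.add_self_eq_zero (u i)

/-! ### Fourier analysis of cosets -/

section Coset

variable {k d : ℕ} (A : Matrix (Fin k) (Fin d) Bit) (v : Bits k)

lemma add_mem_coset (u : Bits k) (z : Bits d) : u + A *ᵥ z ∈ coset A v ↔ u ∈ coset A v := by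
  have key : ∀ u : Bits k, u ∈ coset A v → u + A *ᵥ z ∈ coset A v := by
    rintro u ⟨x, rfl⟩
    exact ⟨x + z, by rw [Matrix.mulVec_add]; abel⟩
  refine ⟨fun h => ?_, key u⟩
  simpa [add_assoc, bits_add_self] using key _ h

/-- The indicator function of `S_c`. -/
def halfInd (c : Bit) (u : Bits k) : ℂ := if u ∈ cosetHalf A v c then 1 else 0

open Classical in
/-- The indicator function of `S`. -/
def cosetInd (u : Bits k) : ℂ := if u ∈ coset A v then 1 else 0

lemma mem_cosetHalf {c : Bit} {u : Bits k} :
    u ∈ cosetHalf A v c ↔ u ∈ coset A v ∧ firstBit u = c := by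
  simp [cosetHalf]

lemma halfInd_eq (c : Bit) (u : Bits k) :
    halfInd A v c u = (1 / 2) * (1 + sgn c * sgn (firstBit u)) * cosetInd A v u := by
  classical
  simp only [halfInd, cosetInd, mem_cosetHalf]
  by_cases h : u ∈ coset A v
  · rcases bit_cases c with rfl | rfl <;> rcases bit_cases (firstBit u) with h' | h' <;>
      simp [h, h'] <;> norm_num
  · simp [h]

/-- The Hadamard transform of the indicator function of `S`. -/
def cosetFourier : Bits k → ℂ := hadamardPow k *ᵥ cosetInd A v

/-- Some column `w` of `A` satisfies `s · w = 1`. Translating the sum by `w` preserves `S` but flips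
the sign of the character, so the value equals its own negative. -/
lemma cosetFourier_eq_zero {s : Bits k} (hs : s ∉ dual A) : cosetFourier A v s = 0 := by
  classical
  have : ∃ j, (s ᵥ* A) j ≠ 0 := by
    by_contra! h
    exact hs (funext h)
  obtain ⟨j, hj⟩ := this
  have hj1 : (s ᵥ* A) j = 1 := (bit_cases _).resolve_left hj
  set w : Bits k := A *ᵥ Pi.single j 1 with hw
  have hsw : s ⬝ᵥ w = 1 := by
    rw [hw, Matrix.dotProduct_mulVec, dotProduct_single, mul_one, hj1]
  have h : cosetFourier A v s = -cosetFourier A v s := by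
    conv_lhs => rw [cosetFourier, Matrix.mulVec, dotProduct, ← Equiv.sum_comp (Equiv.addRight w)]
    rw [cosetFourier, Matrix.mulVec, dotProduct, ← Finset.sum_neg_distrib]
    refine Finset.sum_congr rfl fun u _ => ?_
    have hu : cosetInd A v (u + w) = cosetInd A v u := by
      exact if_congr (add_mem_coset A v u _) rfl rfl
    simp only [Equiv.coe_addRight, hu, hadamardPow_apply, dotProduct_add, sgn_add, hsw, sgn_one]
    ring
  linear_combination (1 / 2 : ℂ) * h

lemma hadamardPow_mulVec_halfInd (c : Bit) (s : Bits k) :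
    (hadamardPow k *ᵥ halfInd A v c) s =
      (1 / 2) * (cosetFourier A v s + sgn c * cosetFourier A v (s + unitFirst k)) := by
  simp only [cosetFourier, Matrix.mulVec, dotProduct, Finset.mul_sum, ← Finset.sum_add_distrib,
    halfInd_eq]
  refine Finset.sum_congr rfl fun u _ => ?_
  rw [hadamardPow_apply, hadamardPow_apply, add_dotProduct, sgn_add, ← firstBit_eq]
  ring

variable {A v}

/-- Otherwise the difference `unitFirst k` would lie in the dual, and the first bit would be
constant on the coset, leaving one half empty. -/
lemma add_unitFirst_notMem_dual (h : ∀ c, (cosetHalf A v c).Nonempty) {s : Bits k}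
    (hs : s ∈ dual A) : s + unitFirst k ∉ dual A := by
  intro hs'
  obtain ⟨u₀, h₀⟩ := h 0
  obtain ⟨u₁, h₁⟩ := h 1
  rw [mem_cosetHalf] at h₀ h₁
  obtain ⟨⟨x₀, rfl⟩, h₀⟩ := h₀
  obtain ⟨⟨x₁, rfl⟩, h₁⟩ := h₁
  have he : unitFirst k ᵥ* A = 0 := by
    have h1 : s ᵥ* A = 0 := hs
    have h2 : (s + unitFirst k) ᵥ* A = 0 := hs'
    rwa [Matrix.add_vecMul, h1, zero_add] at h2
  have hx : ∀ x, firstBit (A *ᵥ x + v) = firstBit v := fun x => by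
    rw [firstBit_add, firstBit_eq (A *ᵥ x), Matrix.dotProduct_mulVec, he, zero_dotProduct,
      zero_add]
  rw [hx] at h₀ h₁
  rw [h₀] at h₁
  exact absurd h₁ (by decide)

/-- The transforms of the two halves differ only in the sign of the term `F(s + e)`, which vanishes
on the dual; off the dual the other term `F(s)` vanishes. So the phase turns one transform into the
other. The phase function is abstract so that the oracle `CK_D` can be substituted for it. -/
lemma rotate_halfInd (h : ∀ c, (cosetHalf A v c).Nonempty) (f : Bits k → Bit)
    (hf : ∀ s, f s = open Classical in if s ∈ dual A then 0 else 1) (c : Bit) :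
    hadamardPow k *ᵥ phase f (hadamardPow k *ᵥ halfInd A v (1 - c)) = halfInd A v c := by
  have key : phase f (hadamardPow k *ᵥ halfInd A v (1 - c)) = hadamardPow k *ᵥ halfInd A v c := by
    funext s
    simp only [phase, hadamardPow_mulVec_halfInd, hf]
    have hc : sgn (1 - c) = -sgn c := by
      rw [sub_eq_add_neg, ZMod.neg_eq_self_mod_two, sgn_add, sgn_one]; ring
    by_cases hs : s ∈ dual A
    · rw [cosetFourier_eq_zero A v (add_unitFirst_notMem_dual h hs)]
      simp [hs]
    · simp only [hs, cosetFourier_eq_zero A v hs, if_false, if_true, hc]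
      ring
  rw [key, Matrix.mulVec_mulVec, hadamardPow_mul_self, Matrix.one_mulVec]

variable (A v) in
lemma sum_norm_sq_halfInd (c : Bit) :
    ∑ u, ‖halfInd A v c u‖ ^ 2 = ((cosetHalf A v c).card : ℝ) := by
  have : ∀ u, ‖halfInd A v c u‖ ^ 2 = if u ∈ cosetHalf A v c then 1 else 0 := fun u => by
    simp only [halfInd]; split_ifs <;> simp
  simp [this]

lemma phase_norm {n : ℕ} (f : Bits n → Bit) (ψ : Bits n → ℂ) (u : Bits n) :
    ‖phase f ψ u‖ = ‖ψ u‖ := by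
  simp only [phase, norm_mul]
  split_ifs <;> simp

lemma hadamardPow_conjTranspose_mul_self (n : ℕ) : (hadamardPow n)ᴴ * hadamardPow n = 1 := by
  rw [hadamardPow_conjTranspose, hadamardPow_mul_self]

/-- The rotation preserves norms and carries one indicator function to the other; their squared
norms are the cardinalities. -/
lemma card_cosetHalf_one_sub (h : ∀ c, (cosetHalf A v c).Nonempty) (c : Bit) :
    (cosetHalf A v (1 - c)).card = (cosetHalf A v c).card := by
  classical
  have h1 := congrArg (fun ψ : Bits k → ℂ => ∑ u, ‖ψ u‖ ^ 2)
    (rotate_halfInd h (fun s => if s ∈ dual A then 0 else 1) (fun s => rfl) c)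
  simp only [sum_norm_sq_mulVec _ (hadamardPow_conjTranspose_mul_self k), phase_norm,
    sum_norm_sq_halfInd] at h1
  exact_mod_cast h1

lemma uniformState_cosetHalf (c : Bit) :
    uniformState (cosetHalf A v c) =
      ((((Real.sqrt ((cosetHalf A v c).card : ℝ))⁻¹ : ℝ)) : ℂ) • halfInd A v c := by
  funext u
  simp [uniformState, halfInd]

lemma phase_smul {n : ℕ} (f : Bits n → Bit) (a : ℂ) (ψ : Bits n → ℂ) :
    phase f (a • ψ) = a • phase f ψ := by
  funext u
  simp only [phase, Pi.smul_apply, smul_eq_mul]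
  ring

theorem rotate_uniformState (h : ∀ c, (cosetHalf A v c).Nonempty) (c : Bit) :
    hadamardPow k *ᵥ phase (fun s => open Classical in if s ∈ dual A then 0 else 1)
      (hadamardPow k *ᵥ uniformState (cosetHalf A v (1 - c))) =
      uniformState (cosetHalf A v c) := by
  rw [uniformState_cosetHalf, uniformState_cosetHalf, Matrix.mulVec_smul, phase_smul,
    Matrix.mulVec_smul, rotate_halfInd h _ (fun s => rfl), card_cosetHalf_one_sub h]

lemma mulVec_injective_of_rank (hA : A.rank = d) :
    Function.Injective A.mulVec := by
  rw [Matrix.mulVec_injective_iff, linearIndependent_iff_card_eq_finrank_span,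
    Fintype.card_fin, Set.finrank, ← Matrix.rank_eq_finrank_span_cols, hA]

lemma sum_card_cosetHalf_eq (hA : A.rank = d) :
    (cosetHalf A v 0).card + (cosetHalf A v 1).card = 2 ^ d := by
  classical
  have hinj : Function.Injective fun x : Bits d => A *ᵥ x + v := by
    intro x y hxy
    have h1 : A *ᵥ x = A *ᵥ y := add_right_cancel hxy
    exact mulVec_injective_of_rank hA h1
  have hcard := Finset.card_image_of_injective Finset.univ hinj
  rw [Finset.card_univ, Fintype.card_fun, ZMod.card, Fintype.card_fin] at hcard
  rw [← hcard, ← Finset.card_union_of_disjoint]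
  · congr 1
    ext u
    simp only [Finset.mem_union, mem_cosetHalf, Finset.mem_image, Finset.mem_univ, true_and,
      coset, Set.mem_ofPred_eq, ← and_or_left, and_iff_left (bit_cases (firstBit u))]
  · rw [Finset.disjoint_left]
    intro u h0 h1
    rw [mem_cosetHalf] at h0 h1
    exact absurd (h0.2.symm.trans h1.2) (by decide)

lemma card_cosetHalf_of_rank (h : ∀ c, (cosetHalf A v c).Nonempty) (hA : A.rank = d) (c : Bit) :
    ((cosetHalf A v c).card : ℝ) = 2 ^ d / 2 := by
  have h1 := sum_card_cosetHalf_eq (v := v) hA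
  have h2 := card_cosetHalf_one_sub h 1
  rw [sub_self] at h2
  have h3 : ((cosetHalf A v 0).card : ℝ) + (cosetHalf A v 1).card = 2 ^ d := by exact_mod_cast h1
  have h4 : ((cosetHalf A v 0).card : ℝ) = (cosetHalf A v 1).card := by exact_mod_cast h2
  rcases bit_cases c with rfl | rfl <;> linarith

end Coset

/-! ### Openings of ideal commitments -/

/-- The outcome distribution of a measurement of the unnormalized pure state `β` in the orthonormal
basis formed by the columns of `H`. -/
def pureDist (H : Matrix Bit Bit ℂ) (β : Bit → ℂ) : Option Bit → ℝ
  | some b => ‖(Hᴴ *ᵥ β) b‖ ^ 2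
  | none => 0

lemma sum_bit {M : Type*} [AddCommMonoid M] (f : Bit → M) : ∑ b, f b = f 0 + f 1 := by
  rw [show (Finset.univ : Finset Bit) = {0, 1} from rfl, Finset.sum_pair (by decide)]

lemma pureDist_nonneg (H : Matrix Bit Bit ℂ) (β : Bit → ℂ) (a : Option Bit) :
    0 ≤ pureDist H β a := by
  cases a with
  | none => exact le_rfl
  | some b => exact sq_nonneg _

lemma sum_pureDist {H : Matrix Bit Bit ℂ} (hH : H * Hᴴ = 1) (β : Bit → ℂ) :
    ∑ a, pureDist H β a = ∑ b, ‖β b‖ ^ 2 := by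
  rw [Fintype.sum_option, ← sum_norm_sq_mulVec Hᴴ (by simpa using hH) β]
  simp [pureDist]

/-- The amplitude of the outcome `o` when the state `∑ b, β b |b⟩ ⊗ Ψ b` is measured in the basis
formed by the columns of `V`. -/
def openAmp {k : ℕ} (V : Matrix (Bit × Bits k) (Bit × Bits k) ℂ) (β : Bit → ℂ)
    (Ψ : Bit → Bits k → ℂ) : Bit × Bits k → ℂ :=
  Vᴴ *ᵥ fun p => β p.1 * Ψ p.1 p.2

lemma sum_norm_sq_openAmp {k : ℕ} {V : Matrix (Bit × Bits k) (Bit × Bits k) ℂ} (hV : V * Vᴴ = 1)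
    (β : Bit → ℂ) (Ψ : Bit → Bits k → ℂ) :
    ∑ o, ‖openAmp V β Ψ o‖ ^ 2 = ∑ b, ‖β b‖ ^ 2 * ∑ u, ‖Ψ b u‖ ^ 2 := by
  rw [openAmp, sum_norm_sq_mulVec Vᴴ (by simpa using hV), Fintype.sum_prod_type]
  simp only [norm_mul, mul_pow, Finset.mul_sum]

lemma openAmp_smul {k : ℕ} (V : Matrix (Bit × Bits k) (Bit × Bits k) ℂ)
    (β : Bit → ℂ) (c : ℂ) (Ψ : Bit → Bits k → ℂ) :
    openAmp V β (c • Ψ) = c • openAmp V β Ψ := by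
  rw [openAmp, openAmp, ← Matrix.mulVec_smul]
  congr 1
  funext p
  simp only [Pi.smul_apply, smul_eq_mul]
  ring

lemma openAmp_sub {k : ℕ} (V : Matrix (Bit × Bits k) (Bit × Bits k) ℂ)
    (β : Bit → ℂ) (Ψ Ψ' : Bit → Bits k → ℂ) :
    openAmp V β Ψ - openAmp V β Ψ' = openAmp V β (Ψ - Ψ') := by
  rw [openAmp, openAmp, openAmp, ← Matrix.mulVec_sub]
  congr 1
  funext p
  simp only [Pi.sub_apply]
  ring

/-! ### Exact decoding from cosets with two non-empty halves -/

section Decoders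

variable {k d : ℕ} (A : Matrix (Fin k) (Fin d) Bit) (v : Bits k)

open Classical in
/-- The decoder for the standard basis. -/
def cosetDecZ (o : Bit × Bits k) : Option Bit :=
  if o.2 ∈ cosetHalf A v o.1 then some o.1 else none

open Classical in
/-- The decoder for the Hadamard basis. -/
def cosetDecX (o : Bit × Bits k) : Option Bit :=
  if o.2 ∈ dual A then some o.1
  else if o.2 + unitFirst k ∈ dual A then some (o.1 + 1) else none

/-- Measuring `V` and decoding by `dec` on a commitment with the coset states for `A` and `v` has the
outcome distribution of measuring the committed qubit in the basis `H`. -/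
def DecodesTo (V : Matrix (Bit × Bits k) (Bit × Bits k) ℂ) (dec : Bit × Bits k → Option Bit)
    (H : Matrix Bit Bit ℂ) : Prop :=
  ∀ (β : Bit → ℂ) (a : Option Bit),
    ∑ o, (if dec o = a then ‖openAmp V β (halfInd A v) o‖ ^ 2 else 0) =
      (cosetHalf A v 0).card * pureDist H β a

/-- It suffices to check `DecodesTo` on the outcomes other than `⊥`, as total weights agree. -/
lemma decodesTo_of_some {V : Matrix (Bit × Bits k) (Bit × Bits k) ℂ}
    {dec : Bit × Bits k → Option Bit} {H : Matrix Bit Bit ℂ}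
    (h : ∀ β b, ∑ o, (if dec o = some b then ‖openAmp V β (halfInd A v) o‖ ^ 2 else 0) =
      (cosetHalf A v 0).card * pureDist H β (some b))
    (hcard : (cosetHalf A v 1).card = (cosetHalf A v 0).card)
    (hV : V * Vᴴ = 1) (hH : H * Hᴴ = 1) : DecodesTo A v V dec H := by
  have htot : ∀ β, ∑ a, ∑ o, (if dec o = a then ‖openAmp V β (halfInd A v) o‖ ^ 2 else 0) =
      ∑ a, (cosetHalf A v 0).card * pureDist H β a := fun β => by
    rw [Finset.sum_comm, ← Finset.mul_sum, sum_pureDist hH]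
    simp only [Finset.sum_ite_eq, Finset.mem_univ, if_true]
    rw [sum_norm_sq_openAmp hV]
    simp only [sum_norm_sq_halfInd, sum_bit, hcard]
    ring
  intro β a
  cases a with
  | some b => exact h β b
  | none =>
    have := htot β
    rw [Fintype.sum_option, Fintype.sum_option] at this
    simp only [h β] at this
    exact add_right_cancel this

variable {A v}

lemma decodesTo_Z (h : ∀ c, (cosetHalf A v c).Nonempty) :
    DecodesTo A v 1 (cosetDecZ A v) 1 := by
  have hcard := card_cosetHalf_one_sub h 0
  rw [sub_zero] at hcard
  refine decodesTo_of_some A v (fun β b => ?_) hcard (by simp) (by simp)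
  -- The amplitude at `(c, u)` is `β c` times the indicator of `S_c`, so whatever the decoder would
  -- reject has amplitude zero.
  have hamp : ∀ o : Bit × Bits k, (if cosetDecZ A v o = some b
      then ‖openAmp 1 β (halfInd A v) o‖ ^ 2 else 0) =
      if o.1 = b then ‖β b‖ ^ 2 * ‖halfInd A v b o.2‖ ^ 2 else 0 := by
    rintro ⟨c, u⟩
    simp only [cosetDecZ, openAmp, Matrix.conjTranspose_one, Matrix.one_mulVec]
    by_cases hc : c = b
    · subst hc
      by_cases hu : u ∈ cosetHalf A v c <;> simp [hu, halfInd]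
    · by_cases hu : u ∈ cosetHalf A v c <;> simp [hu, hc]
  simp only [hamp, Fintype.sum_prod_type]
  rw [Finset.sum_eq_single b (fun c _ hc => by simp [hc]) (by simp)]
  have hb : ((cosetHalf A v b).card : ℝ) = (cosetHalf A v 0).card := by
    rcases bit_cases b with rfl | rfl
    · rfl
    · rw [hcard]
  simp only [if_true, ← Finset.mul_sum, sum_norm_sq_halfInd, pureDist, Matrix.conjTranspose_one,
    Matrix.one_mulVec, hb]
  ring

lemma openAmp_hadamardAll (β : Bit → ℂ) (Ψ : Bit → Bits k → ℂ) (o : Bit × Bits k) :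
    openAmp (hadamardAll k) β Ψ o =
      ∑ b, hadamard o.1 b * β b * (hadamardPow k *ᵥ Ψ b) o.2 := by
  rw [openAmp, hadamardAll, Matrix.conjTranspose_kronecker, hadamard_conjTranspose,
    hadamardPow_conjTranspose, Matrix.mulVec, dotProduct, Fintype.sum_prod_type]
  refine Finset.sum_congr rfl fun b _ => ?_
  rw [Matrix.mulVec, dotProduct, Finset.mul_sum]
  refine Finset.sum_congr rfl fun u _ => ?_
  rw [Matrix.kroneckerMap_apply]
  ring

/-- The Hadamard matrix conjugates a phase flip into a bit flip. This is why the decoder for the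
Hadamard basis has to correct `b` to `b + 1` on the shifted dual. -/
lemma hadamard_mulVec_add_one (β : Bit → ℂ) (b : Bit) :
    (hadamard *ᵥ β) (b + 1) = ∑ c, hadamard b c * sgn c * β c := by
  rw [Matrix.mulVec, dotProduct]
  refine Finset.sum_congr rfl fun c _ => ?_
  rw [hadamard_apply, hadamard_apply, add_mul, one_mul, sgn_add]
  ring

/-- The sign `(-1)^b` in the transform of `S_b` is absorbed into the committed qubit, where it flips
the outcome. At most one of the two terms survives when both halves are non-empty, and `cosetDecX`
reads off which one. -/
lemma openAmp_hadamardAll_halfInd (β : Bit → ℂ) (o : Bit × Bits k) :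
    openAmp (hadamardAll k) β (halfInd A v) o =
      (1 / 2) * ((hadamard *ᵥ β) o.1 * cosetFourier A v o.2 +
        (hadamard *ᵥ β) (o.1 + 1) * cosetFourier A v (o.2 + unitFirst k)) := by
  rw [openAmp_hadamardAll, hadamard_mulVec_add_one, Matrix.mulVec, dotProduct, Finset.sum_mul,
    Finset.sum_mul, ← Finset.sum_add_distrib, Finset.mul_sum]
  refine Finset.sum_congr rfl fun b _ => ?_
  rw [hadamardPow_mulVec_halfInd]
  ring

lemma norm_sq_cosetInd (A : Matrix (Fin k) (Fin d) Bit) (v u : Bits k) :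
    ‖cosetInd A v u‖ ^ 2 = ‖halfInd A v 0 u‖ ^ 2 + ‖halfInd A v 1 u‖ ^ 2 := by
  classical
  simp only [cosetInd, halfInd, mem_cosetHalf]
  by_cases hu : u ∈ coset A v
  · rcases bit_cases (firstBit u) with h' | h' <;> simp [hu, h']
  · simp [hu]

lemma sum_norm_sq_cosetFourier (h : ∀ c, (cosetHalf A v c).Nonempty) :
    ∑ s, ‖cosetFourier A v s‖ ^ 2 = 2 * (cosetHalf A v 0).card := by
  classical
  have hcard := card_cosetHalf_one_sub h 0
  rw [sub_zero] at hcard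
  rw [cosetFourier, sum_norm_sq_mulVec _ (hadamardPow_conjTranspose_mul_self k)]
  simp only [norm_sq_cosetInd, Finset.sum_add_distrib, sum_norm_sq_halfInd, hcard]
  ring

lemma decodesTo_X (h : ∀ c, (cosetHalf A v c).Nonempty) :
    DecodesTo A v (hadamardAll k) (cosetDecX A) hadamard := by
  classical
  have hcard := card_cosetHalf_one_sub h 0
  rw [sub_zero] at hcard
  have hH : hadamard * hadamardᴴ = 1 := by rw [hadamard_conjTranspose, hadamard_mul_self]
  refine decodesTo_of_some A v (fun β b => ?_) hcard (hadamardAll_mul_conjTranspose k) hH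
  -- The two summands come from `s` in the dual with outcome `b`, and from `s` in the shifted dual
  -- with outcome `b + 1`. Off these sets the Fourier factors vanish, so no case distinction on `s`
  -- is left on the right. Each summand has Fourier mass `2 |S_0|`, and the two factors `1/4` bring
  -- the total to `|S_0|`.
  have hamp : ∀ o : Bit × Bits k, (if cosetDecX A o = some b
      then ‖openAmp (hadamardAll k) β (halfInd A v) o‖ ^ 2 else 0) =
      (if o.1 = b then (1 / 4) * ‖(hadamard *ᵥ β) b‖ ^ 2 * ‖cosetFourier A v o.2‖ ^ 2 else 0) +
      (if o.1 = b + 1 then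
        (1 / 4) * ‖(hadamard *ᵥ β) b‖ ^ 2 * ‖cosetFourier A v (o.2 + unitFirst k)‖ ^ 2 else 0) := by
    rintro ⟨c, s⟩
    rw [openAmp_hadamardAll_halfInd]
    have hcb : c + 1 = b ↔ c = b + 1 := by revert b c; decide
    have hbb : b + 1 + 1 = b := by rw [add_assoc, CharTwo.add_self_eq_zero, add_zero]
    simp only [cosetDecX]
    by_cases hs : s ∈ dual A
    · rw [cosetFourier_eq_zero A v (add_unitFirst_notMem_dual h hs)]
      by_cases hc : c = b
      · subst hc
        simp [hs, mul_pow]; norm_num; ring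
      · simp [hs, hc]
    · rw [cosetFourier_eq_zero A v hs]
      by_cases hs' : s + unitFirst k ∈ dual A
      · by_cases hc : c = b + 1
        · subst hc
          simp [hs, hs', hbb, mul_pow]; norm_num; ring
        · simp [hs, hs', hcb, hc]
      · rw [cosetFourier_eq_zero A v hs']
        simp [hs, hs']
  simp only [hamp, Finset.sum_add_distrib, Fintype.sum_prod_type]
  rw [Finset.sum_eq_single b (fun c _ hc => by simp [hc]) (by simp),
    Finset.sum_eq_single (b + 1) (fun c _ hc => by simp [hc]) (by simp)]
  simp only [if_true, ← Finset.mul_sum]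
  rw [show ∑ s, ‖cosetFourier A v (s + unitFirst k)‖ ^ 2 = ∑ s, ‖cosetFourier A v s‖ ^ 2 from
    Equiv.sum_comp (Equiv.addRight (unitFirst k)) fun s => ‖cosetFourier A v s‖ ^ 2,
    sum_norm_sq_cosetFourier h, pureDist, hadamard_conjTranspose]
  ring

end Decoders

/-! ### The state produced by an honest commitment -/

section Honest

variable {r d k : ℕ}

namespace CosetCoins

variable (ω : CosetCoins r d k)

lemma rank_mat (y : Bits r) : (ω.mat y).rank = d := (ω.2 y).1.2

lemma append_hash (x : Bits (r + d)) : Fin.append (ω.hashH x) (ω.hashJ x) = ω.1 x :=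
  Fin.append_castAdd_natAdd

lemma hashH_symm_append (y : Bits r) (z : Bits d) : ω.hashH (ω.1.symm (Fin.append y z)) = y := by
  funext i
  simp [hashH]

lemma hashJ_symm_append (y : Bits r) (z : Bits d) : ω.hashJ (ω.1.symm (Fin.append y z)) = z := by
  funext i
  simp [hashJ]

lemma oracleP_injective : Function.Injective ω.oracleP := by
  intro x x' h
  have h1 : ω.hashH x = ω.hashH x' := congrArg Prod.fst h
  have h2 : ω.mat (ω.hashH x) *ᵥ ω.hashJ x + ω.vec (ω.hashH x) =
    ω.mat (ω.hashH x') *ᵥ ω.hashJ x' + ω.vec (ω.hashH x') := congrArg Prod.snd h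
  rw [← h1] at h2
  have h3 := mulVec_injective_of_rank (ω.rank_mat _) (add_right_cancel h2)
  apply ω.1.injective
  rw [← append_hash, ← append_hash, h1, h3]

end CosetCoins

/-- With honest oracles, the register `X` is returned to zero and `U` is left in the uniform
superposition over `S_y`. -/
lemma cosetGen_honest (ω : CosetCoins r d k) (y : Bits r) (x : Bits (r + d)) :
    cosetGen ω.oracleP ω.oraclePinv y x =
      (if x = 0 then invSqrtTwo ^ (r + d) else 0) • cosetInd (ω.mat y) (ω.vec y) := by
  classical
  funext u
  simp only [cosetGen, cosetInit, sub_eq_zero, Pi.smul_apply, smul_eq_mul]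
  have hcond : ∀ x', (y = (ω.oracleP x').1 ∧ u = (ω.oracleP x').2) ↔ ω.oracleP x' = (y, u) := by
    intro x'
    rw [Prod.ext_iff]
    exact and_congr eq_comm eq_comm
  simp only [hcond]
  by_cases hu : ∃ z : Bits d, ω.mat y *ᵥ z + ω.vec y = u
  · have hu' : u ∈ coset (ω.mat y) (ω.vec y) := hu
    set x₀ := ω.1.symm (Fin.append y hu.choose) with hx₀
    have hinv : ω.oraclePinv y u = some x₀ := by rw [CosetCoins.oraclePinv, dif_pos hu]
    have hP : ω.oracleP x₀ = (y, u) := by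
      rw [CosetCoins.oracleP, hx₀, ω.hashH_symm_append, ω.hashJ_symm_append, hu.choose_spec]
    -- Injectivity of `P` leaves `x - x₀ = x₀`, that is `x = x₀ + x₀`, which is zero in
    -- characteristic two.
    have hx : ω.oracleP (x - x₀) = (y, u) ↔ x = 0 := by
      rw [← hP, ω.oracleP_injective.eq_iff, sub_eq_iff_eq_add, bits_add_self]
    simp only [hinv, Option.getD_some, hx, cosetInd, hu', if_true, mul_one]
    rfl
  · have hu' : u ∉ coset (ω.mat y) (ω.vec y) := hu
    have hinv : ω.oraclePinv y u = none := by rw [CosetCoins.oraclePinv, dif_neg hu]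
    have hx : ¬ ω.oracleP x = (y, u) := by
      intro h
      have h1 : ω.hashH x = y := congrArg Prod.fst h
      have h2 : ω.mat (ω.hashH x) *ᵥ ω.hashJ x + ω.vec (ω.hashH x) = u := congrArg Prod.snd h
      rw [h1] at h2
      exact hu ⟨_, h2⟩
    simp [hinv, hx, cosetInd, hu']

lemma sum_norm_sq_cosetInd {A : Matrix (Fin k) (Fin d) Bit} (hA : A.rank = d) (v : Bits k) :
    ∑ u, ‖cosetInd A v u‖ ^ 2 = 2 ^ d := by
  classical
  simp only [norm_sq_cosetInd, Finset.sum_add_distrib, sum_norm_sq_halfInd]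
  exact_mod_cast sum_card_cosetHalf_eq hA

lemma norm_sq_invSqrtTwo_pow (n : ℕ) : ‖invSqrtTwo ^ n‖ ^ 2 = (1 / 2) ^ n := by
  rw [norm_pow, ← pow_mul, mul_comm, pow_mul, invSqrtTwo_norm_sq]

lemma half_pow_add_mul (r d : ℕ) : ((1 : ℝ) / 2) ^ (r + d) * 2 ^ d = (1 / 2) ^ r := by
  rw [pow_add, mul_assoc, ← mul_pow]
  norm_num

/-- The coset has `2^d` elements whatever the setup randomness, so `y` is uniformly distributed and
independent of it. This lets the event of an empty half be studied at a fixed `y`. -/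
lemma sum_norm_sq_cosetGen_honest (ω : CosetCoins r d k) (y : Bits r) :
    ∑ x, ∑ u, ‖cosetGen ω.oracleP ω.oraclePinv y x u‖ ^ 2 = (1 / 2) ^ r := by
  rw [Finset.sum_eq_single 0]
  · simp only [cosetGen_honest, if_true, Pi.smul_apply, smul_eq_mul, norm_mul, mul_pow]
    rw [← Finset.mul_sum, sum_norm_sq_cosetInd (ω.rank_mat y), ← half_pow_add_mul r d,
      ← norm_sq_invSqrtTwo_pow]
  · intro x _ hx
    simp [cosetGen_honest, hx]
  · simp

/-! ### The committing map on product states of the signer's register and `U` -/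

variable {oss : OneShotSignature}

/-- The product of a state of the signer's register and a state of `U`. -/
def regTensor (φ : oss.Reg → ℂ) (χ : Bits k → ℂ) : oss.Reg → Bits k → ℂ := fun z u => φ z * χ u

lemma onReg_regTensor (V : Matrix oss.Reg oss.Reg ℂ) (φ : oss.Reg → ℂ) (χ : Bits k → ℂ) :
    onReg V (regTensor φ χ) = regTensor (V *ᵥ φ) χ := by
  funext z u
  simp only [onReg, regTensor, Matrix.mulVec, dotProduct, Finset.sum_mul, mul_assoc]

lemma onReg_add (V : Matrix oss.Reg oss.Reg ℂ) (Φ Ψ : oss.Reg → Bits k → ℂ) :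
    onReg V (Φ + Ψ) = onReg V Φ + onReg V Ψ := by
  funext z u
  simp only [onReg, Pi.add_apply, mul_add, Finset.sum_add_distrib]

variable (oss) in
/-- The part of the state `φ` of the signer's register on which the verification of a signature of
`m` fails. -/
def rejectPart (O : oss.Oracle) (vk : Bits oss.vkLen) (m : Bit) (φ : oss.Reg → ℂ) : oss.Reg → ℂ :=
  fun z => if oss.ver O vk m z.1 = true then 0 else φ z

lemma collapse_regTensor_cosetInd (φ : oss.Reg → ℂ) (c : ℂ) (A : Matrix (Fin k) (Fin d) Bit)
    (v : Bits k) (b : Bit) :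
    collapse b (regTensor φ (c • cosetInd A v)) = regTensor φ (c • halfInd A v b) := by
  classical
  funext z u
  simp only [collapse, regTensor, Pi.smul_apply, smul_eq_mul, cosetInd, halfInd, mem_cosetHalf]
  by_cases h1 : firstBit u = b <;> by_cases h2 : u ∈ coset A v <;> simp [h1, h2]

lemma phase_zero {n : ℕ} (ψ : Bits n → ℂ) : phase (fun _ => 0) ψ = ψ := by
  funext u
  simp [phase]

/-- Argued for each basis state of the signer's register. Where the signature of `0` is accepted,
the phase is the one of `rotate_halfInd`. Where it is rejected, the phase is trivial, the two
Hadamard transforms cancel, and the state stays on the wrong half; the second summand records the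
discrepancy. -/
lemma rotate_regTensor_halfInd (O : oss.Oracle) (f : Bits oss.vkLen → CosetCoins r d k)
    (vk : Bits oss.vkLen) (y : Bits r) (φ : oss.Reg → ℂ) (c : ℂ) (b : Bit)
    (h : ∀ c, (cosetHalf ((f vk).mat y) ((f vk).vec y) c).Nonempty) :
    rotate (fun σ u => (commitOracles oss O f).D vk σ y u)
        (regTensor φ (c • halfInd ((f vk).mat y) ((f vk).vec y) (1 - b))) =
      regTensor φ (c • halfInd ((f vk).mat y) ((f vk).vec y) b) +
        regTensor (rejectPart oss O vk 0 φ)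
          (c • (halfInd ((f vk).mat y) ((f vk).vec y) (1 - b) -
            halfInd ((f vk).mat y) ((f vk).vec y) b)) := by
  classical
  funext z
  have hslice : ∀ χ : Bits k → ℂ, regTensor φ (c • χ) z = (φ z * c) • χ := fun χ => by
    funext u
    simp only [regTensor, Pi.smul_apply, smul_eq_mul]
    ring
  rw [rotate, hslice, Matrix.mulVec_smul, phase_smul, Matrix.mulVec_smul, Pi.add_apply, hslice]
  by_cases hver : oss.ver O vk 0 z.1 = true
  · have hr := rotate_halfInd h (fun u => ((commitOracles oss O f).D vk z.1 y u).getD 0) (fun s => by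
      simp only [commitOracles, hver, if_true, Option.getD_some, CosetCoins.oracleD]
      by_cases hs : s ∈ dual ((f vk).mat y) <;> simp [hs]) b
    rw [hr]
    funext u
    simp [regTensor, rejectPart, hver]
  · have hD : (fun u => ((commitOracles oss O f).D vk z.1 y u).getD 0) = fun _ => 0 := by
      funext u
      simp [commitOracles, hver]
    rw [hD, phase_zero, Matrix.mulVec_mulVec, hadamardPow_mul_self, Matrix.one_mulVec]
    funext u
    simp only [regTensor, rejectPart, hver, Pi.add_apply, Pi.smul_apply, Pi.sub_apply, smul_eq_mul]
    simp only [Bool.false_eq_true, if_false]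
    ring

variable (oss) in
/-- The signer's state after signing `m`. -/
def signed (O : oss.Oracle) (vk : Bits oss.vkLen) (a : Bits oss.auxLen) (m : Bit) : oss.Reg → ℂ :=
  (oss.sign O m : Matrix oss.Reg oss.Reg ℂ) *ᵥ oss.gen O vk a

variable (oss) in
/-- The contribution to the final state of the signer of the failures to sign `0`. -/
def signError (O : oss.Oracle) (vk : Bits oss.vkLen) (a : Bits oss.auxLen) : oss.Reg → ℂ :=
  (oss.sign O 1 : Matrix oss.Reg oss.Reg ℂ) *ᵥ
    ((oss.sign O 0 : Matrix oss.Reg oss.Reg ℂ)ᴴ *ᵥ rejectPart oss O vk 0 (signed oss O vk a 0))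

lemma sign_conjTranspose_mul (O : oss.Oracle) (m : Bit) :
    (oss.sign O m : Matrix oss.Reg oss.Reg ℂ)ᴴ * oss.sign O m = 1 :=
  Matrix.mem_unitaryGroup_iff'.mp (oss.sign O m).2

lemma sign_mul_conjTranspose (O : oss.Oracle) (m : Bit) :
    (oss.sign O m : Matrix oss.Reg oss.Reg ℂ) * (oss.sign O m : Matrix oss.Reg oss.Reg ℂ)ᴴ = 1 :=
  Matrix.mem_unitaryGroup_iff.mp (oss.sign O m).2

lemma bit_eq_one_sub_of_ne : ∀ {a b : Bit}, a ≠ b → a = 1 - b := by decide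

/-- Apart from the rejected part, the signer's register stays in a product with `U`, so undoing the
signature of `0` restores the key state and `1` can be signed as if `0` never had been. The main
term does not depend on the measured bit `b'`, so that measurement reveals nothing about `b`; the
error occurs only in the branch that rotates. -/
lemma commitState_honest (O : oss.Oracle) (f : Bits oss.vkLen → CosetCoins r d k)
    (vk : Bits oss.vkLen) (a : Bits oss.auxLen) (x : Bits (r + d)) (y : Bits r) (b' : Bit)
    (z : oss.Reg) (b : Bit) (h : ∀ c, (cosetHalf ((f vk).mat y) ((f vk).vec y) c).Nonempty) :
    commitState (commitOracles oss O f) ((vk, a), (x, y), b', z) b =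
      (if x = 0 then invSqrtTwo ^ (r + d) else 0) •
        (signed oss O vk a 1 z • halfInd ((f vk).mat y) ((f vk).vec y) b +
          if b' = b then 0 else signError oss O vk a z •
            (halfInd ((f vk).mat y) ((f vk).vec y) (1 - b) -
              halfInd ((f vk).mat y) ((f vk).vec y) b)) := by
  set c : ℂ := if x = 0 then invSqrtTwo ^ (r + d) else 0
  have hΦ₀ : (fun z u => signed oss O vk a 0 z *
      cosetGen ((commitOracles oss O f).P vk) ((commitOracles oss O f).Pinv vk) y x u) =
      regTensor (signed oss O vk a 0) (c • cosetInd ((f vk).mat y) ((f vk).vec y)) := by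
    rw [← cosetGen_honest]
    rfl
  have hback : (oss.sign O 0 : Matrix oss.Reg oss.Reg ℂ)ᴴ *ᵥ signed oss O vk a 0 =
      oss.gen O vk a := by
    rw [signed, Matrix.mulVec_mulVec, sign_conjTranspose_mul, Matrix.one_mulVec]
  have hgoal : commitState (commitOracles oss O f) ((vk, a), (x, y), b', z) b =
      onReg (oss.sign O 1 : Matrix oss.Reg oss.Reg ℂ)
        (onReg (oss.sign O 0 : Matrix oss.Reg oss.Reg ℂ)ᴴ
          (if b' = b then collapse b' (regTensor (signed oss O vk a 0)
              (c • cosetInd ((f vk).mat y) ((f vk).vec y)))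
            else rotate (fun σ u => (commitOracles oss O f).D vk σ y u)
              (collapse b' (regTensor (signed oss O vk a 0)
              (c • cosetInd ((f vk).mat y) ((f vk).vec y)))))) z := by
    rw [← hΦ₀]
    rfl
  rw [hgoal]
  by_cases hb : b' = b
  · subst hb
    rw [if_pos rfl, if_pos rfl, collapse_regTensor_cosetInd, onReg_regTensor, onReg_regTensor,
      hback]
    funext u
    simp only [regTensor, signed, Pi.smul_apply, Pi.add_apply, smul_eq_mul, Pi.zero_apply]
    ring
  · have hb' : b' = 1 - b := bit_eq_one_sub_of_ne hb
    rw [if_neg hb, if_neg hb, collapse_regTensor_cosetInd, hb',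
      rotate_regTensor_halfInd _ _ _ _ _ _ _ h, onReg_add, onReg_add, onReg_regTensor, onReg_regTensor,
      onReg_regTensor, onReg_regTensor, hback]
    funext u
    simp only [regTensor, signed, signError, Pi.smul_apply, Pi.add_apply, smul_eq_mul]
    ring

/-- The probability that the outcomes of both key generations are `e` and `p`, on input `b`. -/
lemma sum_norm_sq_commitState (ck : CommitOracles oss r d k) (b : Bit)
    (e : Bits oss.vkLen × Bits oss.auxLen) (p : Bits (r + d) × Bits r) :
    ∑ q : Bit × oss.Reg, ∑ u, ‖commitState ck (e, p, q) b u‖ ^ 2 =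
      (∑ z, ‖oss.gen ck.O e.1 e.2 z‖ ^ 2) *
        ∑ u, ‖cosetGen (ck.P e.1) (ck.Pinv e.1) p.2 p.1 u‖ ^ 2 := by
  rw [Fintype.sum_prod_type, ← sum_norm_sq_mulVec _ (sign_conjTranspose_mul ck.O 0),
    Finset.sum_mul_sum]
  simp only [← mul_pow, ← norm_mul]
  rw [← collapse_norm]
  refine Finset.sum_congr rfl fun c _ => ?_
  simp only [commitState]
  rw [onReg_norm _ (sign_conjTranspose_mul ck.O 1), onReg_norm _ (by
    rw [Matrix.conjTranspose_conjTranspose]; exact sign_mul_conjTranspose ck.O 0)]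
  split_ifs
  · rfl
  · exact rotate_norm _ _

end Honest

/-! ### Comparing outcome distributions -/

/-- Classical post-processing by `dec` cannot increase the distance. For the undecoded outcomes,
`|a² - b²| = |a - b| (a + b)` and Cauchy–Schwarz is applied to each product. -/
lemma sum_abs_norm_sq_sub_le {J α : Type*} [Fintype J] [Fintype α] [DecidableEq α] (dec : J → α)
    (w w' : J → ℂ) :
    ∑ a, |∑ j, (if dec j = a then ‖w j‖ ^ 2 else 0) - ∑ j, (if dec j = a then ‖w' j‖ ^ 2 else 0)| ≤
      √(∑ j, ‖w j - w' j‖ ^ 2) * (√(∑ j, ‖w j‖ ^ 2) + √(∑ j, ‖w' j‖ ^ 2)) := by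
  calc _ ≤ ∑ a, ∑ j, (if dec j = a then |‖w j‖ ^ 2 - ‖w' j‖ ^ 2| else 0) := by
        refine Finset.sum_le_sum fun a _ => ?_
        rw [← Finset.sum_sub_distrib]
        refine (Finset.abs_sum_le_sum_abs _ _).trans (Finset.sum_le_sum fun j _ => ?_)
        split_ifs <;> simp
    _ = ∑ j, |‖w j‖ ^ 2 - ‖w' j‖ ^ 2| := by
        rw [Finset.sum_comm]
        simp
    _ ≤ ∑ j, (‖w j - w' j‖ * ‖w j‖ + ‖w j - w' j‖ * ‖w' j‖) := by
        refine Finset.sum_le_sum fun j _ => ?_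
        rw [sq_sub_sq, abs_mul, abs_of_nonneg (by positivity : 0 ≤ ‖w j‖ + ‖w' j‖), ← mul_add,
          mul_comm]
        exact mul_le_mul_of_nonneg_right (abs_norm_sub_norm_le _ _) (by positivity)
    _ ≤ _ := by
        rw [Finset.sum_add_distrib, mul_add]
        exact add_le_add (Real.sum_mul_le_sqrt_mul_sqrt _ _ _) (Real.sum_mul_le_sqrt_mul_sqrt _ _ _)

lemma sum_sum_ite_eq {J α M : Type*} [Fintype J] [Fintype α] [DecidableEq α] [AddCommMonoid M]
    (dec : J → α) (f : J → M) : ∑ a, ∑ j, (if dec j = a then f j else 0) = ∑ j, f j := by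
  rw [Finset.sum_comm]
  simp

/-! ### Error bounds for one outcome `(vk, a, y)` of the two key generations -/

section Local

variable {oss : OneShotSignature} {r d k : ℕ}

variable (oss) in
/-- The probability of obtaining the outcomes `vk, a` in key generation. -/
def genWeight (O : oss.Oracle) (vk : Bits oss.vkLen) (a : Bits oss.auxLen) : ℝ :=
  ∑ z, ‖oss.gen O vk a z‖ ^ 2

variable (oss) in
/-- The probability of obtaining the outcomes `vk, a` in key generation and failing to sign `m`. -/
def rejectWeight (O : oss.Oracle) (vk : Bits oss.vkLen) (a : Bits oss.auxLen) (m : Bit) : ℝ :=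
  ∑ z, ‖rejectPart oss O vk m (signed oss O vk a m) z‖ ^ 2

lemma genWeight_nonneg (O : oss.Oracle) (vk : Bits oss.vkLen) (a : Bits oss.auxLen) :
    0 ≤ genWeight oss O vk a := by unfold genWeight; positivity

lemma rejectWeight_nonneg (O : oss.Oracle) (vk : Bits oss.vkLen) (a : Bits oss.auxLen) (m : Bit) :
    0 ≤ rejectWeight oss O vk a m := by unfold rejectWeight; positivity

lemma sum_norm_sq_signed (O : oss.Oracle) (vk : Bits oss.vkLen) (a : Bits oss.auxLen) (m : Bit) :
    ∑ z, ‖signed oss O vk a m z‖ ^ 2 = genWeight oss O vk a :=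
  sum_norm_sq_mulVec _ (sign_conjTranspose_mul O m) _

lemma sum_norm_sq_signError (O : oss.Oracle) (vk : Bits oss.vkLen) (a : Bits oss.auxLen) :
    ∑ z, ‖signError oss O vk a z‖ ^ 2 = rejectWeight oss O vk a 0 := by
  rw [signError, sum_norm_sq_mulVec _ (sign_conjTranspose_mul O 1), sum_norm_sq_mulVec _ (by
    rw [Matrix.conjTranspose_conjTranspose]; exact sign_mul_conjTranspose O 0), rejectWeight]

variable (oss) in
/-- Decoding that outputs `⊥` unless the signature of `1` is accepted. -/
def checkedDec (O : oss.Oracle) (vk : Bits oss.vkLen) (dec : Bit × Bits k → Option Bit)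
    (z : oss.Reg) (o : Bit × Bits k) : Option Bit :=
  if oss.ver O vk 1 z.1 = true then dec o else none

/-- The probability that `vk`, `a` and `y` are obtained by an honest commitment to `β` and the
opening in the basis `V` is decoded to `out`. -/
def localDist (O : oss.Oracle) (f : Bits oss.vkLen → CosetCoins r d k)
    (V : Matrix (Bit × Bits k) (Bit × Bits k) ℂ) (dec : Bit × Bits k → Option Bit) (β : Bit → ℂ)
    (vk : Bits oss.vkLen) (a : Bits oss.auxLen) (y : Bits r) (out : Option Bit) : ℝ :=
  ∑ x, ∑ q : Bit × oss.Reg, ∑ o, if checkedDec oss O vk dec q.2 o = out then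
    ‖openAmp V β (commitState (commitOracles oss O f) ((vk, a), (x, y), q)) o‖ ^ 2 else 0

variable (O : oss.Oracle) (f : Bits oss.vkLen → CosetCoins r d k)
    {V : Matrix (Bit × Bits k) (Bit × Bits k) ℂ} (dec : Bit × Bits k → Option Bit) (β : Bit → ℂ)
    (vk : Bits oss.vkLen) (a : Bits oss.auxLen) (y : Bits r)

lemma localDist_nonneg (out : Option Bit) : 0 ≤ localDist O f V dec β vk a y out := by
  unfold localDist
  refine Finset.sum_nonneg fun x _ => Finset.sum_nonneg fun q _ => Finset.sum_nonneg fun o _ => ?_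
  split_ifs <;> positivity

lemma sum_norm_sq_openAmp_commitState (hV : V * Vᴴ = 1) (x : Bits (r + d)) :
    ∑ q : Bit × oss.Reg, ∑ o,
      ‖openAmp V β (commitState (commitOracles oss O f) ((vk, a), (x, y), q)) o‖ ^ 2 =
    (∑ b, ‖β b‖ ^ 2) * (genWeight oss O vk a *
      ∑ u, ‖cosetGen (f vk).oracleP (f vk).oraclePinv y x u‖ ^ 2) := by
  simp only [sum_norm_sq_openAmp hV]
  rw [Finset.sum_comm, Finset.sum_mul]
  refine Finset.sum_congr rfl fun b _ => ?_
  rw [← Finset.mul_sum, sum_norm_sq_commitState]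
  rfl

lemma sum_localDist (hV : V * Vᴴ = 1) :
    ∑ out, localDist O f V dec β vk a y out =
      (1 / 2) ^ r * genWeight oss O vk a * ∑ b, ‖β b‖ ^ 2 := by
  have : ∀ x, ∑ out, ∑ q : Bit × oss.Reg, ∑ o, (if checkedDec oss O vk dec q.2 o = out then
      ‖openAmp V β (commitState (commitOracles oss O f) ((vk, a), (x, y), q)) o‖ ^ 2 else 0) =
      ∑ q : Bit × oss.Reg, ∑ o,
        ‖openAmp V β (commitState (commitOracles oss O f) ((vk, a), (x, y), q)) o‖ ^ 2 := by
    intro x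
    rw [Finset.sum_comm]
    exact Finset.sum_congr rfl fun q _ => sum_sum_ite_eq _ _
  simp only [localDist]
  rw [Finset.sum_comm]
  simp only [this, sum_norm_sq_openAmp_commitState O f β vk a y hV]
  rw [← Finset.mul_sum, ← Finset.mul_sum, sum_norm_sq_cosetGen_honest]
  ring

variable {H : Matrix Bit Bit ℂ}

/-- The triangle inequality: both terms are non-negative with the same total mass. Nothing is
assumed about the coset, so this serves when a half is empty. -/
lemma localDist_bound_of_bad (hV : V * Vᴴ = 1) (hH : H * Hᴴ = 1) :
    ∑ out, |localDist O f V dec β vk a y out - (1 / 2) ^ r * genWeight oss O vk a * pureDist H β out|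
      ≤ (1 / 2) ^ r * (∑ b, ‖β b‖ ^ 2) * (2 * genWeight oss O vk a) := by
  have hg := genWeight_nonneg O vk a
  calc _ ≤ ∑ out, (localDist O f V dec β vk a y out +
          (1 / 2) ^ r * genWeight oss O vk a * pureDist H β out) := by
        refine Finset.sum_le_sum fun out _ => (abs_sub _ _).trans_eq ?_
        rw [abs_of_nonneg (localDist_nonneg ..), abs_of_nonneg]
        exact mul_nonneg (by positivity) (pureDist_nonneg ..)
    _ = _ := by
        rw [Finset.sum_add_distrib, sum_localDist O f dec β vk a y hV, ← Finset.mul_sum,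
          sum_pureDist hH]
        ring

/-- Amplitudes of an ideal commitment, which does not depend on how `0` is signed. -/
def idealAmp (V : Matrix (Bit × Bits k) (Bit × Bits k) ℂ) (j : (Bit × oss.Reg) × (Bit × Bits k)) :
    ℂ :=
  invSqrtTwo ^ (r + d) * signed oss O vk a 1 j.1.2 *
    openAmp V β (halfInd ((f vk).mat y) ((f vk).vec y)) j.2

/-- Ideal amplitudes factor into a signer part and an opening part, so the check of the signature of
`1` is independent of the opened value. Given acceptance, `DecodesTo` yields the exact distribution;
given rejection, all the mass sits on `⊥`. -/
lemma sum_idealAmp (h : ∀ c, (cosetHalf ((f vk).mat y) ((f vk).vec y) c).Nonempty)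
    (hdec : DecodesTo ((f vk).mat y) ((f vk).vec y) V dec H) (hH : H * Hᴴ = 1) (out : Option Bit) :
    ∑ j : (Bit × oss.Reg) × (Bit × Bits k), (if checkedDec oss O vk dec j.1.2 j.2 = out then
      ‖idealAmp O f β vk a y V j‖ ^ 2 else 0) =
    (1 / 2) ^ r * ∑ z, ‖signed oss O vk a 1 z‖ ^ 2 *
      (if oss.ver O vk 1 z.1 = true then pureDist H β out
        else if out = none then ∑ b, ‖β b‖ ^ 2 else 0) := by
  set A := (f vk).mat y
  set v := (f vk).vec y
  have hA : A.rank = d := (f vk).rank_mat y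
  have hcard := card_cosetHalf_of_rank h hA 0
  have htot : ∑ o, ‖openAmp V β (halfInd A v) o‖ ^ 2 = (2 ^ d / 2) * ∑ b, ‖β b‖ ^ 2 := by
    rw [← hcard, ← sum_pureDist hH, Finset.mul_sum, ← sum_sum_ite_eq dec]
    exact Finset.sum_congr rfl fun a _ => hdec β a
  have hz : ∀ z : oss.Reg, ∑ o, (if checkedDec oss O vk dec z o = out then
      ‖openAmp V β (halfInd A v) o‖ ^ 2 else 0) = (2 ^ d / 2) *
      (if oss.ver O vk 1 z.1 = true then pureDist H β out
        else if out = none then ∑ b, ‖β b‖ ^ 2 else 0) := by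
    intro z
    by_cases hver : oss.ver O vk 1 z.1 = true
    · simp only [checkedDec, hver, if_true]
      rw [hdec β out, hcard]
    · simp only [checkedDec, hver, if_false, Bool.false_eq_true]
      by_cases hout : out = none
      · simp [hout, htot]
      · simp [hout, Ne.symm hout]
  rw [Fintype.sum_prod_type, Fintype.sum_prod_type, sum_bit]
  -- Both values of the measured bit contribute equally. The resulting factor `2` cancels the `1/2`
  -- in the size `2^d / 2` of a half.
  refine (two_mul _).symm.trans ?_
  rw [Finset.mul_sum, Finset.mul_sum]
  refine Finset.sum_congr rfl fun z _ => ?_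
  have : ∀ o, (if checkedDec oss O vk dec z o = out then
      ‖idealAmp O f β vk a y V ((0, z), o)‖ ^ 2 else 0) =
      (1 / 2) ^ (r + d) * ‖signed oss O vk a 1 z‖ ^ 2 * (if checkedDec oss O vk dec z o = out then
      ‖openAmp V β (halfInd A v) o‖ ^ 2 else 0) := by
    intro o
    rw [mul_ite, mul_zero, idealAmp, norm_mul, norm_mul, mul_pow, mul_pow, norm_sq_invSqrtTwo_pow]
  simp only [this, ← Finset.mul_sum, hz]
  rw [← half_pow_add_mul r d]
  ring

lemma sum_norm_sq_idealAmp (h : ∀ c, (cosetHalf ((f vk).mat y) ((f vk).vec y) c).Nonempty)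
    (hV : V * Vᴴ = 1) :
    ∑ j : (Bit × oss.Reg) × (Bit × Bits k), ‖idealAmp O f β vk a y V j‖ ^ 2 =
      (1 / 2) ^ r * genWeight oss O vk a * ∑ b, ‖β b‖ ^ 2 := by
  have hcard := card_cosetHalf_of_rank h ((f vk).rank_mat y)
  rw [Fintype.sum_prod_type, Fintype.sum_prod_type, sum_bit]
  refine (two_mul _).symm.trans ?_
  simp only [idealAmp, norm_mul, mul_pow, norm_sq_invSqrtTwo_pow, ← Finset.mul_sum,
    ← Finset.sum_mul, sum_norm_sq_signed, sum_norm_sq_openAmp hV, sum_norm_sq_halfInd, hcard]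
  rw [← half_pow_add_mul r d]
  ring

/-- The amplitudes of a run with honest oracles in which the register `X` is found to be zero. -/
def realAmp (V : Matrix (Bit × Bits k) (Bit × Bits k) ℂ) (j : (Bit × oss.Reg) × (Bit × Bits k)) :
    ℂ :=
  openAmp V β (commitState (commitOracles oss O f) ((vk, a), (0, y), j.1)) j.2

lemma commitState_honest_of_ne (h : ∀ c, (cosetHalf ((f vk).mat y) ((f vk).vec y) c).Nonempty)
    {x : Bits (r + d)} (hx : x ≠ 0) (q : Bit × oss.Reg) :
    commitState (commitOracles oss O f) ((vk, a), (x, y), q) = 0 := by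
  funext b
  rw [← Prod.mk.eta (p := q), commitState_honest O f vk a x y q.1 q.2 b h, if_neg hx, zero_smul]
  rfl

lemma localDist_eq (h : ∀ c, (cosetHalf ((f vk).mat y) ((f vk).vec y) c).Nonempty)
    (out : Option Bit) :
    localDist O f V dec β vk a y out =
      ∑ j : (Bit × oss.Reg) × (Bit × Bits k), (if checkedDec oss O vk dec j.1.2 j.2 = out then
        ‖realAmp O f β vk a y V j‖ ^ 2 else 0) := by
  have h0 : ∀ o, openAmp V β (0 : Bit → Bits k → ℂ) o = 0 := fun o => by
    have := congrFun (openAmp_smul V β 0 (0 : Bit → Bits k → ℂ)) o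
    simpa using this
  rw [localDist, Finset.sum_eq_single 0]
  · exact (Fintype.sum_prod_type fun j : (Bit × oss.Reg) × (Bit × Bits k) =>
      if checkedDec oss O vk dec j.1.2 j.2 = out then
        ‖realAmp O f β vk a y V j‖ ^ 2 else 0).symm
  · intro x _ hx
    refine Finset.sum_eq_zero fun q _ => Finset.sum_eq_zero fun o _ => ?_
    rw [commitState_honest_of_ne O f vk a y h hx, h0]
    simp
  · simp

lemma sum_norm_sq_realAmp (h : ∀ c, (cosetHalf ((f vk).mat y) ((f vk).vec y) c).Nonempty)
    (hV : V * Vᴴ = 1) :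
    ∑ j : (Bit × oss.Reg) × (Bit × Bits k), ‖realAmp O f β vk a y V j‖ ^ 2 =
      (1 / 2) ^ r * genWeight oss O vk a * ∑ b, ‖β b‖ ^ 2 := by
  -- The total mass does not depend on the decoder, so an arbitrary constant one is inserted.
  rw [← sum_localDist O f (fun _ => none) β vk a y hV,
    ← sum_sum_ite_eq fun j : (Bit × oss.Reg) × (Bit × Bits k) =>
      checkedDec oss O vk (fun _ => none) j.1.2 j.2]
  exact Finset.sum_congr rfl fun out _ => (localDist_eq O f _ β vk a y h out).symm

lemma sum_norm_sq_halfInd_sub (A : Matrix (Fin k) (Fin d) Bit) (hA : A.rank = d) (v : Bits k)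
    (b : Bit) : ∑ u, ‖(halfInd A v (1 - b) - halfInd A v b) u‖ ^ 2 = 2 ^ d := by
  rw [← sum_norm_sq_cosetInd hA v]
  refine Finset.sum_congr rfl fun u _ => ?_
  have hc : ∀ b : Bit, sgn (1 - b) = -sgn b := fun b => by
    rw [sub_eq_add_neg, ZMod.neg_eq_self_mod_two, sgn_add, sgn_one]; ring
  have hn : ∀ b : Bit, ‖sgn b‖ = 1 := fun b => by rcases bit_cases b with rfl | rfl <;> simp
  have : (halfInd A v (1 - b) - halfInd A v b) u =
      -(sgn b * sgn (firstBit u) * cosetInd A v u) := by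
    rw [Pi.sub_apply, halfInd_eq, halfInd_eq, hc]
    ring
  rw [this, norm_neg, norm_mul, norm_mul, hn, hn, one_mul, one_mul]

/-- The difference is the error term of `commitState_honest`. For measured bit `b'` it lives on the
branch `b = 1 - b'` alone, so summing over `b'` produces each `‖β b‖ ^ 2` once. The opening
measurement and the signing unitaries preserve its norm. -/
lemma sum_norm_sq_realAmp_sub (h : ∀ c, (cosetHalf ((f vk).mat y) ((f vk).vec y) c).Nonempty)
    (hV : V * Vᴴ = 1) :
    ∑ j : (Bit × oss.Reg) × (Bit × Bits k),
        ‖realAmp O f β vk a y V j - idealAmp O f β vk a y V j‖ ^ 2 =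
      (1 / 2) ^ r * rejectWeight oss O vk a 0 * ∑ b, ‖β b‖ ^ 2 := by
  set A := (f vk).mat y
  set v := (f vk).vec y
  have hA : A.rank = d := (f vk).rank_mat y
  have hdiff : ∀ (q : Bit × oss.Reg) (o : Bit × Bits k),
      realAmp O f β vk a y V (q, o) - idealAmp O f β vk a y V (q, o) =
      openAmp V β (fun b => if q.1 = b then 0 else (invSqrtTwo ^ (r + d) * signError oss O vk a q.2) •
        (halfInd A v (1 - b) - halfInd A v b)) o := by
    rintro ⟨b', z⟩ o
    have h1 : idealAmp O f β vk a y V ((b', z), o) = openAmp V β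
        ((invSqrtTwo ^ (r + d) * signed oss O vk a 1 z) • halfInd A v) o := by
      rw [openAmp_smul]
      rfl
    rw [h1, realAmp, ← Pi.sub_apply, openAmp_sub]
    congr 2
    funext b
    rw [Pi.sub_apply, commitState_honest O f vk a 0 y b' z b h, if_pos rfl, Pi.smul_apply]
    split_ifs
    · rw [add_zero, smul_smul, sub_self]
    · rw [smul_add, smul_smul, smul_smul, add_sub_cancel_left]
  have hq : ∀ q : Bit × oss.Reg,
      ∑ o, ‖realAmp O f β vk a y V (q, o) - idealAmp O f β vk a y V (q, o)‖ ^ 2 =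
      ‖β (1 - q.1)‖ ^ 2 * ((1 / 2) ^ r * ‖signError oss O vk a q.2‖ ^ 2) := by
    rintro ⟨b', z⟩
    simp only [hdiff]
    rw [sum_norm_sq_openAmp hV, Finset.sum_eq_single (1 - b')]
    · have hne : b' ≠ 1 - b' := by revert b'; decide
      simp only [if_neg hne, Pi.smul_apply, smul_eq_mul, norm_mul, mul_pow]
      rw [← Finset.mul_sum, sum_norm_sq_halfInd_sub A hA, norm_sq_invSqrtTwo_pow,
        ← half_pow_add_mul r d]
      ring
    · intro b _ hb
      have : b' = b := by
        by_contra hne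
        exact hb (bit_eq_one_sub_of_ne (Ne.symm hne))
      simp [this]
    · simp
  rw [Fintype.sum_prod_type]
  simp only [hq]
  rw [Fintype.sum_prod_type]
  simp only [← Finset.mul_sum, sum_norm_sq_signError]
  rw [sum_bit, sum_bit, sub_zero, sub_self]
  ring

lemma localDist_bound_of_good (h : ∀ c, (cosetHalf ((f vk).mat y) ((f vk).vec y) c).Nonempty)
    (hdec : DecodesTo ((f vk).mat y) ((f vk).vec y) V dec H) (hV : V * Vᴴ = 1) (hH : H * Hᴴ = 1) :
    ∑ out, |localDist O f V dec β vk a y out - (1 / 2) ^ r * genWeight oss O vk a * pureDist H β out|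
      ≤ (1 / 2) ^ r * (∑ b, ‖β b‖ ^ 2) *
        (2 * (√(genWeight oss O vk a) * √(rejectWeight oss O vk a 0)) +
          2 * rejectWeight oss O vk a 1) := by
  set N := ∑ b, ‖β b‖ ^ 2
  have hN : 0 ≤ N := by positivity
  set I : Option Bit → ℝ := fun out => ∑ j : (Bit × oss.Reg) × (Bit × Bits k),
    (if checkedDec oss O vk dec j.1.2 j.2 = out then ‖idealAmp O f β vk a y V j‖ ^ 2 else 0)
  have h1 : ∑ out, |localDist O f V dec β vk a y out - I out| ≤
      (1 / 2) ^ r * N * (2 * (√(genWeight oss O vk a) * √(rejectWeight oss O vk a 0))) := by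
    simp only [localDist_eq O f dec β vk a y h, I]
    refine (sum_abs_norm_sq_sub_le (fun j : (Bit × oss.Reg) × (Bit × Bits k) =>
      checkedDec oss O vk dec j.1.2 j.2) (realAmp O f β vk a y V)
      (idealAmp O f β vk a y V)).trans_eq ?_
    rw [sum_norm_sq_realAmp O f β vk a y h hV, sum_norm_sq_idealAmp O f β vk a y h hV,
      sum_norm_sq_realAmp_sub O f β vk a y h hV]
    have hs : ∀ w : ℝ, √((1 / 2) ^ r * w * N) = √((1 / 2) ^ r * N) * √w := fun w => by
      rw [← Real.sqrt_mul (by positivity)]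
      congr 1
      ring
    rw [hs, hs]
    have := Real.mul_self_sqrt (show 0 ≤ (1 / 2) ^ r * N by positivity)
    linear_combination (2 * √(genWeight oss O vk a) * √(rejectWeight oss O vk a 0)) * this
  -- The ideal distribution deviates from the target only where the signature of `1` is rejected:
  -- there the output is `⊥` instead of a sample of `pureDist`.
  have h2 : ∀ out, I out - (1 / 2) ^ r * genWeight oss O vk a * pureDist H β out =
      (1 / 2) ^ r * rejectWeight oss O vk a 1 * ((if out = none then N else 0) - pureDist H β out) := by
    intro out
    simp only [I, sum_idealAmp O f dec β vk a y h hdec hH, rejectWeight,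
      ← sum_norm_sq_signed O vk a 1, mul_assoc, Finset.sum_mul, ← mul_sub,
      ← Finset.sum_sub_distrib]
    congr 1
    refine Finset.sum_congr rfl fun z _ => ?_
    by_cases hver : oss.ver O vk 1 z.1 = true
    · simp [rejectPart, hver]
    · simp [rejectPart, hver, N, mul_sub]
  have h3 : ∑ out, |I out - (1 / 2) ^ r * genWeight oss O vk a * pureDist H β out| ≤
      (1 / 2) ^ r * N * (2 * rejectWeight oss O vk a 1) := by
    have hrej := rejectWeight_nonneg O vk a 1
    calc _ ≤ ∑ out, (1 / 2) ^ r * rejectWeight oss O vk a 1 *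
          ((if out = none then N else 0) + pureDist H β out) := by
          refine Finset.sum_le_sum fun out _ => ?_
          rw [h2, abs_mul, abs_of_nonneg (by positivity)]
          refine mul_le_mul_of_nonneg_left ((abs_sub _ _).trans_eq ?_) (by positivity)
          rw [abs_of_nonneg (pureDist_nonneg ..), abs_of_nonneg (by split_ifs <;> simp [hN])]
      _ = _ := by
          rw [← Finset.mul_sum, Finset.sum_add_distrib, sum_pureDist hH]
          simp only [Finset.sum_ite_eq', Finset.mem_univ, if_true]
          ring
  calc _ ≤ ∑ out, (|localDist O f V dec β vk a y out - I out| +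
        |I out - (1 / 2) ^ r * genWeight oss O vk a * pureDist H β out|) :=
        Finset.sum_le_sum fun out _ => abs_sub_le _ _ _
    _ ≤ _ := by
        rw [Finset.sum_add_distrib, mul_add]
        exact add_le_add h1 h3

end Local

/-! ### The total variation distance for fixed parameters -/

open Classical in
/-- The indicator of the event that one of the two halves of the coset `S_y` is empty. -/
def badInd {r d k : ℕ} (ω : CosetCoins r d k) (y : Bits r) : ℝ :=
  if ∀ c, (cosetHalf (ω.mat y) (ω.vec y) c).Nonempty then 0 else 1

section Global

variable {oss : OneShotSignature} {r d k : ℕ}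

/-- A measurement together with a decoder which recovers the outcome of measuring in the basis `H`
from a commitment with any coset that has two non-empty halves. -/
structure IsOpening (V : Matrix (Bit × Bits k) (Bit × Bits k) ℂ)
    (D : Matrix (Fin k) (Fin d) Bit → Bits k → Bit × Bits k → Option Bit)
    (H : Matrix Bit Bit ℂ) : Prop where
  basis : V * Vᴴ = 1
  qubitBasis : H * Hᴴ = 1
  decodes : ∀ A v, (∀ c, (cosetHalf A v c).Nonempty) → DecodesTo A v V (D A v) H

lemma isOpening_Z : IsOpening (k := k) (d := d) 1 cosetDecZ 1 :=
  ⟨by simp, by simp, fun _ _ h => decodesTo_Z h⟩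

lemma isOpening_X : IsOpening (k := k) (d := d) (hadamardAll k) (fun A _ => cosetDecX A) hadamard :=
  ⟨hadamardAll_mul_conjTranspose k, by rw [hadamard_conjTranspose, hadamard_mul_self],
    fun _ _ h => decodesTo_X h⟩

/-- The distribution of the decoded outcome for a fixed oracle and fixed setup randomness. -/
def keyDist (O : oss.Oracle) (f : Bits oss.vkLen → CosetCoins r d k)
    (V : Matrix (Bit × Bits k) (Bit × Bits k) ℂ)
    (D : Matrix (Fin k) (Fin d) Bit → Bits k → Bit × Bits k → Option Bit)
    (β : Bit → ℂ) (out : Option Bit) : ℝ :=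
  ∑ e : Bits oss.vkLen × Bits oss.auxLen, ∑ y,
    localDist O f V (D ((f e.1).mat y) ((f e.1).vec y)) β e.1 e.2 y out

variable {V : Matrix (Bit × Bits k) (Bit × Bits k) ℂ}
  {D : Matrix (Fin k) (Fin d) Bit → Bits k → Bit × Bits k → Option Bit} {H : Matrix Bit Bit ℂ}

lemma localDist_bound (hop : IsOpening V D H) (O : oss.Oracle)
    (f : Bits oss.vkLen → CosetCoins r d k) (β : Bit → ℂ) (vk : Bits oss.vkLen)
    (a : Bits oss.auxLen) (y : Bits r) :
    ∑ out, |localDist O f V (D ((f vk).mat y) ((f vk).vec y)) β vk a y out -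
        (1 / 2) ^ r * genWeight oss O vk a * pureDist H β out| ≤
      (1 / 2) ^ r * (∑ b, ‖β b‖ ^ 2) *
        (2 * (√(genWeight oss O vk a) * √(rejectWeight oss O vk a 0)) +
          2 * rejectWeight oss O vk a 1 + 2 * (genWeight oss O vk a * badInd (f vk) y)) := by
  by_cases h : ∀ c, (cosetHalf ((f vk).mat y) ((f vk).vec y) c).Nonempty
  · simp only [badInd, if_pos h, mul_zero, add_zero]
    exact localDist_bound_of_good O f _ β vk a y h (hop.decodes _ _ h) hop.basis hop.qubitBasis
  · simp only [badInd, if_neg h, mul_one]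
    refine (localDist_bound_of_bad O f _ β vk a y hop.basis hop.qubitBasis).trans ?_
    have := rejectWeight_nonneg O vk a 1
    refine mul_le_mul_of_nonneg_left (le_add_of_nonneg_left (by positivity)) (by positivity)

lemma sum_genWeight (O : oss.Oracle) :
    ∑ e : Bits oss.vkLen × Bits oss.auxLen, genWeight oss O e.1 e.2 = 1 := by
  rw [Fintype.sum_prod_type]
  exact oss.gen_norm O

lemma sum_half_pow (r : ℕ) (c : ℝ) : ∑ _y : Bits r, (1 / 2 : ℝ) ^ r * c = c := by
  rw [Finset.sum_const, Finset.card_univ, Fintype.card_fun, ZMod.card, Fintype.card_fin,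
    nsmul_eq_mul, Nat.cast_pow, ← mul_assoc, ← mul_pow]
  norm_num

variable (oss) in
/-- The probability that signing `m` fails for the oracle `O`. -/
def rejectProb (O : oss.Oracle) (m : Bit) : ℝ :=
  ∑ e : Bits oss.vkLen × Bits oss.auxLen, rejectWeight oss O e.1 e.2 m

lemma rejectProb_nonneg (O : oss.Oracle) (m : Bit) : 0 ≤ rejectProb oss O m :=
  Finset.sum_nonneg fun _ _ => rejectWeight_nonneg ..

lemma keyDist_bound (hop : IsOpening V D H) (O : oss.Oracle)
    (f : Bits oss.vkLen → CosetCoins r d k) (β : Bit → ℂ) :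
    ∑ out, |pureDist H β out - keyDist O f V D β out| ≤
      (∑ b, ‖β b‖ ^ 2) * (2 * √(rejectProb oss O 0) + 2 * rejectProb oss O 1 +
        2 * ∑ e : Bits oss.vkLen × Bits oss.auxLen, ∑ y,
          (1 / 2) ^ r * (genWeight oss O e.1 e.2 * badInd (f e.1) y)) := by
  set N := ∑ b, ‖β b‖ ^ 2
  have hN : 0 ≤ N := by positivity
  -- The target is split over `(vk, a, y)` with the probabilities of these outcomes, so that the
  -- local bounds can be summed.
  have hmeas : ∀ out, pureDist H β out = ∑ e : Bits oss.vkLen × Bits oss.auxLen, ∑ _y : Bits r,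
      (1 / 2) ^ r * genWeight oss O e.1 e.2 * pureDist H β out := fun out => by
    simp only [mul_assoc, sum_half_pow]
    rw [← Finset.sum_mul, sum_genWeight, one_mul]
  -- Cauchy–Schwarz over the outcomes of key generation, whose weights sum to one.
  have hcs : ∑ e : Bits oss.vkLen × Bits oss.auxLen,
      √(genWeight oss O e.1 e.2) * √(rejectWeight oss O e.1 e.2 0) ≤ √(rejectProb oss O 0) := by
    have h := Real.sum_sqrt_mul_sqrt_le Finset.univ
      (f := fun e : Bits oss.vkLen × Bits oss.auxLen => genWeight oss O e.1 e.2)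
      (g := fun e => rejectWeight oss O e.1 e.2 0) (fun e => genWeight_nonneg O e.1 e.2)
      (fun e => rejectWeight_nonneg O e.1 e.2 0)
    refine h.trans_eq ?_
    rw [sum_genWeight, Real.sqrt_one, one_mul, rejectProb]
  calc _ ≤ ∑ out, ∑ e : Bits oss.vkLen × Bits oss.auxLen, ∑ y,
        |localDist O f V (D ((f e.1).mat y) ((f e.1).vec y)) β e.1 e.2 y out -
          (1 / 2) ^ r * genWeight oss O e.1 e.2 * pureDist H β out| := by
        refine Finset.sum_le_sum fun out _ => ?_
        have hd : keyDist O f V D β out - pureDist H β out =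
            ∑ e : Bits oss.vkLen × Bits oss.auxLen, ∑ y,
              (localDist O f V (D ((f e.1).mat y) ((f e.1).vec y)) β e.1 e.2 y out -
                (1 / 2) ^ r * genWeight oss O e.1 e.2 * pureDist H β out) := by
          conv_lhs => rw [hmeas out]
          simp only [keyDist, Finset.sum_sub_distrib]
        rw [abs_sub_comm, hd]
        exact (Finset.abs_sum_le_sum_abs _ _).trans
          (Finset.sum_le_sum fun e _ => Finset.abs_sum_le_sum_abs _ _)
    _ = ∑ e : Bits oss.vkLen × Bits oss.auxLen, ∑ y, ∑ out,
        |localDist O f V (D ((f e.1).mat y) ((f e.1).vec y)) β e.1 e.2 y out -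
          (1 / 2) ^ r * genWeight oss O e.1 e.2 * pureDist H β out| := by
        rw [Finset.sum_comm]
        exact Finset.sum_congr rfl fun e _ => Finset.sum_comm
    _ ≤ ∑ e : Bits oss.vkLen × Bits oss.auxLen, ∑ y : Bits r, (1 / 2) ^ r * N *
        (2 * (√(genWeight oss O e.1 e.2) * √(rejectWeight oss O e.1 e.2 0)) +
          2 * rejectWeight oss O e.1 e.2 1 + 2 * (genWeight oss O e.1 e.2 * badInd (f e.1) y)) :=
        Finset.sum_le_sum fun e _ => Finset.sum_le_sum fun y _ => localDist_bound hop O f β _ _ _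
    _ = N * (2 * (∑ e : Bits oss.vkLen × Bits oss.auxLen,
            √(genWeight oss O e.1 e.2) * √(rejectWeight oss O e.1 e.2 0)) +
          2 * rejectProb oss O 1 + 2 * ∑ e : Bits oss.vkLen × Bits oss.auxLen, ∑ y,
          (1 / 2) ^ r * (genWeight oss O e.1 e.2 * badInd (f e.1) y)) := by
        clear_value N
        rw [rejectProb, Finset.mul_sum, Finset.mul_sum, Finset.mul_sum, ← Finset.sum_add_distrib,
          ← Finset.sum_add_distrib, Finset.mul_sum]
        refine Finset.sum_congr rfl fun e _ => ?_
        simp only [mul_assoc]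
        simp only [mul_add, Finset.sum_add_distrib, sum_half_pow]
        congr 1
        rw [Finset.mul_sum, Finset.mul_sum]
        refine Finset.sum_congr rfl fun y _ => ?_
        ring
    _ ≤ _ := by gcongr

/-- Jensen for the concave square root, here by Cauchy–Schwarz. It moves the average over the setup
coins inside the root, since correctness of the signature scheme is only an average statement. -/
lemma expect_sqrt_le {ι : Type*} [Fintype ι] [Nonempty ι] (x : ι → ℝ) (hx : ∀ i, 0 ≤ x i) :
    𝔼 i, √(x i) ≤ √(𝔼 i, x i) := by
  apply Real.le_sqrt_of_sq_le
  rw [Fintype.expect_eq_sum_div_card, Fintype.expect_eq_sum_div_card, div_pow,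
    div_le_div_iff₀ (by positivity) (by positivity)]
  have h := sq_sum_le_card_mul_sum_sq (s := Finset.univ) (f := fun i => √(x i))
  simp only [Real.sq_sqrt (hx _), Finset.card_univ] at h
  calc _ ≤ (Fintype.card ι * ∑ i, x i) * (Fintype.card ι : ℝ) :=
        mul_le_mul_of_nonneg_right h (by positivity)
    _ = _ := by ring

lemma expect_rejectProb (m : Bit) :
    𝔼 R : oss.Coins, rejectProb oss (oss.setup R) m = 1 - oss.acceptProb m := by
  rw [OneShotSignature.acceptProb, ← Fintype.expect_one (ι := oss.Coins),
    ← Finset.expect_sub_distrib]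
  refine Finset.expect_congr rfl fun R _ => ?_
  rw [← sum_genWeight (oss.setup R), rejectProb, Fintype.sum_prod_type, Fintype.sum_prod_type,
    ← Finset.sum_sub_distrib]
  refine Finset.sum_congr rfl fun vk _ => ?_
  rw [← Finset.sum_sub_distrib]
  refine Finset.sum_congr rfl fun a _ => ?_
  rw [← sum_norm_sq_signed _ vk a m, ← Finset.sum_sub_distrib]
  refine Finset.sum_congr rfl fun z _ => ?_
  simp only [rejectPart, signed]
  split_ifs <;> simp

/-- The average over the keys of `keyDist`. -/
def avgDist (prf : KeyedFunction oss.vkLen (CosetCoins r d k))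
    (V : Matrix (Bit × Bits k) (Bit × Bits k) ℂ)
    (D : Matrix (Fin k) (Fin d) Bit → Bits k → Bit × Bits k → Option Bit)
    (β : Bit → ℂ) (out : Option Bit) : ℝ :=
  𝔼 R : oss.Coins, 𝔼 key : prf.Key, keyDist (oss.setup R) (prf.eval key) V D β out

/-- The weights of `(vk, a, y)` do not involve the key of the pseudorandom function, so the average
over keys passes inside and a bound uniform in `(vk, y)` suffices. -/
lemma expect_bad_le (prf : KeyedFunction oss.vkLen (CosetCoins r d k)) {B : ℝ}
    (hB : ∀ vk y, 𝔼 key, badInd (prf.eval key vk) y ≤ B) (O : oss.Oracle) :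
    𝔼 key, ∑ e : Bits oss.vkLen × Bits oss.auxLen, ∑ y,
      (1 / 2) ^ r * (genWeight oss O e.1 e.2 * badInd (prf.eval key e.1) y) ≤ B := by
  rw [Finset.expect_sum_comm]
  calc _ ≤ ∑ e : Bits oss.vkLen × Bits oss.auxLen, ∑ _y : Bits r,
        (1 / 2) ^ r * (genWeight oss O e.1 e.2 * B) := by
        refine Finset.sum_le_sum fun e _ => ?_
        rw [Finset.expect_sum_comm]
        refine Finset.sum_le_sum fun y _ => ?_
        rw [← Finset.mul_expect, ← Finset.mul_expect]
        have := genWeight_nonneg O e.1 e.2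
        have := hB e.1 y
        gcongr
    _ = B := by
        simp only [sum_half_pow]
        rw [← Finset.sum_mul, sum_genWeight, one_mul]

lemma avgDist_bound (hop : IsOpening V D H) (prf : KeyedFunction oss.vkLen (CosetCoins r d k))
    {B : ℝ} (hB : ∀ vk y, 𝔼 key, badInd (prf.eval key vk) y ≤ B) (β : Bit → ℂ) :
    ∑ out, |pureDist H β out - avgDist prf V D β out| ≤
      (∑ b, ‖β b‖ ^ 2) *
        (2 * √(1 - oss.acceptProb 0) + 2 * (1 - oss.acceptProb 1) + 2 * B) := by
  set N := ∑ b, ‖β b‖ ^ 2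
  have hN : 0 ≤ N := by positivity
  calc _ ≤ ∑ out, 𝔼 R : oss.Coins, 𝔼 key : prf.Key,
        |pureDist H β out - keyDist (oss.setup R) (prf.eval key) V D β out| := by
        refine Finset.sum_le_sum fun out _ => ?_
        have h1 : pureDist H β out - avgDist prf V D β out = 𝔼 R : oss.Coins, 𝔼 key : prf.Key,
            (pureDist H β out - keyDist (oss.setup R) (prf.eval key) V D β out) := by
          simp only [Finset.expect_sub_distrib, Fintype.expect_const, avgDist]
        rw [h1]
        exact (Finset.abs_expect_le _ _).trans
          (Finset.expect_le_expect fun R _ => Finset.abs_expect_le _ _)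
    _ = 𝔼 R : oss.Coins, 𝔼 key : prf.Key, ∑ out,
        |pureDist H β out - keyDist (oss.setup R) (prf.eval key) V D β out| := by
        rw [← Finset.expect_sum_comm]
        exact Finset.expect_congr rfl fun R _ => (Finset.expect_sum_comm _ _ _).symm
    _ ≤ 𝔼 R : oss.Coins, 𝔼 key : prf.Key, N *
        (2 * √(rejectProb oss (oss.setup R) 0) + 2 * rejectProb oss (oss.setup R) 1 +
        2 * ∑ e : Bits oss.vkLen × Bits oss.auxLen, ∑ y,
          (1 / 2) ^ r * (genWeight oss (oss.setup R) e.1 e.2 * badInd (prf.eval key e.1) y)) :=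
        Finset.expect_le_expect fun R _ => Finset.expect_le_expect fun key _ =>
          keyDist_bound hop _ _ β
    _ ≤ 𝔼 R : oss.Coins, N *
        (2 * √(rejectProb oss (oss.setup R) 0) + 2 * rejectProb oss (oss.setup R) 1 + 2 * B) := by
        refine Finset.expect_le_expect fun R _ => ?_
        rw [← Finset.mul_expect, Finset.expect_add_distrib, Fintype.expect_const,
          ← Finset.mul_expect]
        have := expect_bad_le prf hB (oss.setup R)
        gcongr
    _ = N * (2 * (𝔼 R : oss.Coins, √(rejectProb oss (oss.setup R) 0)) +
          2 * (1 - oss.acceptProb 1) + 2 * B) := by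
        rw [← Finset.mul_expect, Finset.expect_add_distrib, Finset.expect_add_distrib,
          Fintype.expect_const, ← Finset.mul_expect, ← Finset.mul_expect, expect_rejectProb]
    _ ≤ _ := by
        rw [← expect_rejectProb 0]
        have := expect_sqrt_le (fun R : oss.Coins => rejectProb oss (oss.setup R) 0)
          fun R => rejectProb_nonneg _ _
        gcongr

/-! ### From amplitudes to density matrices -/

lemma trace_vecMulVec_mul_vecMulVec_re {ι : Type*} [Fintype ι] (φ Φ : ι → ℂ) :
    (Matrix.vecMulVec φ (star φ) * Matrix.vecMulVec Φ (star Φ)).trace.re =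
      ‖star φ ⬝ᵥ Φ‖ ^ 2 := by
  have h : φ ⬝ᵥ star Φ = star (star φ ⬝ᵥ Φ) := by
    rw [Matrix.star_dotProduct, star_star, dotProduct_comm]
  rw [Matrix.vecMulVec_mul_vecMulVec, Matrix.trace_vecMulVec, dotProduct_smul, smul_eq_mul, h,
    Complex.star_def, Complex.mul_conj, Complex.ofReal_re, Complex.normSq_eq_norm_sq]

lemma trace_basisProj_mul (V : Matrix (Bit × Bits k) (Bit × Bits k) ℂ) (β : Bit → ℂ)
    (Ψ : Bit → Bits k → ℂ) (o : Bit × Bits k) :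
    (basisProj V o * Matrix.of fun p q : Bit × Bits k =>
      Ψ p.1 p.2 * Matrix.vecMulVec β (star β) p.1 q.1 * star (Ψ q.1 q.2)).trace.re =
      ‖openAmp V β Ψ o‖ ^ 2 := by
  have h1 : (Matrix.of fun p q : Bit × Bits k =>
      Ψ p.1 p.2 * Matrix.vecMulVec β (star β) p.1 q.1 * star (Ψ q.1 q.2)) =
      Matrix.vecMulVec (fun p => β p.1 * Ψ p.1 p.2) (star fun p => β p.1 * Ψ p.1 p.2) := by
    ext p q
    simp only [Matrix.of_apply, Matrix.vecMulVec_apply, Pi.star_apply, star_mul']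
    ring
  rw [h1, basisProj, trace_vecMulVec_mul_vecMulVec_re]
  rfl

lemma experiment_eq_avgDist (prf : KeyedFunction oss.vkLen (CosetCoins r d k))
    (dec : oss.Coins × prf.Key → Bits oss.vkLen × Bits oss.sigLen × Bits r →
      Bit × Bits k → Option Bit)
    (hdec : ∀ dk c o, dec dk c o = if oss.ver (oss.setup dk.1) c.1 1 c.2.1 = true then
      D ((prf.eval dk.2 c.1).mat c.2.2) ((prf.eval dk.2 c.1).vec c.2.2) o else none)
    (β : Bit → ℂ) (out : Option Bit) :
    (construction oss prf).experiment (basisProj V) dec (Matrix.vecMulVec β (star β)) out =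
      avgDist prf V D β out := by
  have hunfold : (construction oss prf).experiment (basisProj V) dec
      (Matrix.vecMulVec β (star β)) out = 𝔼 R : oss.Coins × prf.Key, ∑ t : CommitTrace oss r d, ∑ o,
      if dec R (t.1.1, t.2.2.2.1, t.2.1.2) o = out then
        ‖openAmp V β (commitState (commitOracles oss (oss.setup R.1) (prf.eval R.2)) t) o‖ ^ 2
      else 0 := by
    simp only [← trace_basisProj_mul]
    rfl
  rw [hunfold, ← Finset.univ_product_univ, Finset.expect_product, avgDist]
  refine Finset.expect_congr rfl fun R _ => Finset.expect_congr rfl fun key _ => ?_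
  rw [Fintype.sum_prod_type, keyDist]
  refine Finset.sum_congr rfl fun e _ => ?_
  rw [Fintype.sum_prod_type, Fintype.sum_prod_type, Finset.sum_comm]
  refine Finset.sum_congr rfl fun y _ => Finset.sum_congr rfl fun x _ =>
    Finset.sum_congr rfl fun q _ => Finset.sum_congr rfl fun o _ => ?_
  simp only [hdec, checkedDec]
  rfl

lemma experiment_sum (pfc : PauliFunctionalCommitment)
    (opn : pfc.Opening → Matrix (Bit × Bits pfc.uLen) (Bit × Bits pfc.uLen) ℂ)
    (dec : pfc.DecodeKey → pfc.ComString → pfc.Opening → Option Bit) {m : ℕ}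
    (ρ : Fin m → Matrix Bit Bit ℂ) (a : Option Bit) :
    pfc.experiment opn dec (∑ i, ρ i) a = ∑ i, pfc.experiment opn dec (ρ i) a := by
  have hc : ∀ ck t, pfc.committed ck (∑ i, ρ i) t = ∑ i, pfc.committed ck (ρ i) t := by
    intro ck t
    ext p q
    simp only [PauliFunctionalCommitment.committed, Matrix.of_apply, Matrix.sum_apply,
      Finset.mul_sum, Finset.sum_mul]
  simp only [PauliFunctionalCommitment.experiment]
  rw [← Finset.expect_sum_comm]
  refine Finset.expect_congr rfl fun R _ => ?_
  refine Eq.trans ?_ Finset.sum_comm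
  refine Finset.sum_congr rfl fun t _ => ?_
  refine Eq.trans ?_ Finset.sum_comm
  refine Finset.sum_congr rfl fun o _ => ?_
  rw [hc, Matrix.mul_sum, Matrix.trace_sum, Complex.re_sum]
  split_ifs <;> simp

lemma measZ_conj_vecMulVec (H : Matrix Bit Bit ℂ) {m : ℕ} (β : Fin m → Bit → ℂ) (a : Option Bit) :
    measZ (Hᴴ * (∑ i, Matrix.vecMulVec (β i) (star (β i))) * H) a = ∑ i, pureDist H (β i) a := by
  cases a with
  | none => simp [measZ, pureDist]
  | some b =>
    rw [Matrix.mul_sum, Matrix.sum_mul]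
    simp only [measZ, Matrix.sum_apply, Complex.re_sum, pureDist]
    refine Finset.sum_congr rfl fun i _ => ?_
    rw [Matrix.mul_vecMulVec, Matrix.vecMulVec_mul, Matrix.vecMulVec_apply]
    have : (star (β i) ᵥ* H) b = star ((Hᴴ *ᵥ β i) b) := by
      rw [← Pi.star_apply (Hᴴ *ᵥ β i), Matrix.star_mulVec, Matrix.conjTranspose_conjTranspose]
    rw [this, Complex.star_def, Complex.mul_conj, Complex.ofReal_re, Complex.normSq_eq_norm_sq]

/-- Correctness of one opening for fixed parameters. -/
theorem tvDist_experiment_le (hop : IsOpening V D H)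
    (prf : KeyedFunction oss.vkLen (CosetCoins r d k))
    (dec : oss.Coins × prf.Key → Bits oss.vkLen × Bits oss.sigLen × Bits r →
      Bit × Bits k → Option Bit)
    (hdec : ∀ dk c o, dec dk c o = if oss.ver (oss.setup dk.1) c.1 1 c.2.1 = true then
      D ((prf.eval dk.2 c.1).mat c.2.2) ((prf.eval dk.2 c.1).vec c.2.2) o else none)
    {B : ℝ} (hB : ∀ vk y, 𝔼 key, badInd (prf.eval key vk) y ≤ B)
    {ρ : Matrix Bit Bit ℂ} (hρ : ρ.PosSemidef) (htr : ρ.trace = 1) :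
    tvDist (measZ (Hᴴ * ρ * H)) ((construction oss prf).experiment (basisProj V) dec ρ) ≤
      √(1 - oss.acceptProb 0) + (1 - oss.acceptProb 1) + B := by
  -- The mixed state becomes a sum of unnormalized pure states whose squared norms add up to the
  -- trace `1`. The bound for each is proportional to its squared norm, so the sum loses nothing.
  obtain ⟨m, β, rfl⟩ := Matrix.posSemidef_iff_eq_sum_vecMulVec.mp hρ
  have hnorm : ∑ i, ∑ b, ‖β i b‖ ^ 2 = 1 := by
    have h := congrArg Complex.re htr
    rw [Matrix.trace_sum, Complex.re_sum, Complex.one_re] at h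
    rw [← h]
    refine Finset.sum_congr rfl fun i _ => ?_
    rw [Matrix.trace, Complex.re_sum]
    refine Finset.sum_congr rfl fun b _ => ?_
    rw [Matrix.diag_apply, Matrix.vecMulVec_apply, Pi.star_apply, Complex.star_def,
      Complex.mul_conj, Complex.ofReal_re, Complex.normSq_eq_norm_sq]
  rw [tvDist, div_le_iff₀ (by norm_num)]
  calc _ ≤ ∑ a, ∑ i, |pureDist H (β i) a - avgDist prf V D (β i) a| := by
        refine Finset.sum_le_sum fun a _ => ?_
        have hE : (construction oss prf).experiment (basisProj V) dec
            (∑ i, Matrix.vecMulVec (β i) (star (β i))) a = ∑ i, avgDist prf V D (β i) a :=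
          (experiment_sum (construction oss prf) _ _ _ a).trans
            (Finset.sum_congr rfl fun i _ => experiment_eq_avgDist prf dec hdec (β i) a)
        rw [measZ_conj_vecMulVec, hE, ← Finset.sum_sub_distrib]
        exact Finset.abs_sum_le_sum_abs _ _
    _ = ∑ i, ∑ a, |pureDist H (β i) a - avgDist prf V D (β i) a| := Finset.sum_comm
    _ ≤ ∑ i, (∑ b, ‖β i b‖ ^ 2) *
        (2 * √(1 - oss.acceptProb 0) + 2 * (1 - oss.acceptProb 1) + 2 * B) :=
        Finset.sum_le_sum fun i _ => avgDist_bound hop prf hB (β i)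
    _ = _ := by
        rw [← Finset.sum_mul, hnorm]
        ring

theorem tvDist_pfc_le (prf : KeyedFunction oss.vkLen (CosetCoins r d k))
    {B : ℝ} (hB : ∀ vk y, 𝔼 key, badInd (prf.eval key vk) y ≤ B)
    {ρ : Matrix Bit Bit ℂ} (hρ : ρ.PosSemidef) (htr : ρ.trace = 1) :
    tvDist (measZ ρ) ((construction oss prf).pfcZ ρ) ≤
        √(1 - oss.acceptProb 0) + (1 - oss.acceptProb 1) + B ∧
      tvDist (measX ρ) ((construction oss prf).pfcX ρ) ≤
        √(1 - oss.acceptProb 0) + (1 - oss.acceptProb 1) + B := by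
  refine ⟨?_, tvDist_experiment_le isOpening_X prf _ (fun dk c o => rfl) hB hρ htr⟩
  have h := tvDist_experiment_le isOpening_Z prf (construction oss prf).decZ
    (fun dk c o => rfl) hB hρ htr
  rwa [Matrix.conjTranspose_one, one_mul, mul_one] at h

end Global

/-! ### Random full rank matrices -/

section RandomMatrix

variable {k d : ℕ}

lemma card_ker_vecMul {A : Matrix (Fin k) (Fin d) Bit} (hA : A.rank = d) :
    Nat.card {x : Bits k // x ᵥ* A = 0} * 2 ^ d = 2 ^ k := by
  have h := LinearMap.finrank_range_add_finrank_ker Aᵀ.mulVecLin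
  have hr : Module.finrank Bit (LinearMap.range Aᵀ.mulVecLin) = d :=
    (Matrix.rank_transpose A).trans hA
  rw [hr, Module.finrank_fin_fun] at h
  have hc : Nat.card {x : Bits k // x ᵥ* A = 0} = Nat.card (LinearMap.ker Aᵀ.mulVecLin) := by
    refine Nat.card_congr (Equiv.subtypeEquivRight fun x => ?_)
    rw [LinearMap.mem_ker, Matrix.mulVecLin_apply, Matrix.mulVec_transpose]
  rw [hc, Module.natCard_eq_pow_finrank (K := Bit), Nat.card_zmod, ← pow_add, add_comm, h]

/-- The transvection which adds the combination of the rows other than `i` with coefficients `c` to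
row `i`. -/
def shearMatrix (i : Fin k) (c : Bits k) : Matrix (Fin k) (Fin k) Bit :=
  1 + Matrix.vecMulVec (Pi.single i 1) (Function.update c i 0)

/-- The rank one part squares to zero because coordinate `i` of `c` is reset to `0`, and the cross
terms cancel in characteristic two. Hence shearing permutes the full rank matrices and preserves
their uniform distribution. -/
lemma shearMatrix_mul_self (i : Fin k) (c : Bits k) : shearMatrix i c * shearMatrix i c = 1 := by
  have h2 : ∀ M : Matrix (Fin k) (Fin k) Bit, M + M = 0 := fun M => by
    ext a b
    exact CharTwo.add_self_eq_zero _
  have h0 : Matrix.vecMulVec (Pi.single i 1) (Function.update c i 0) *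
      Matrix.vecMulVec (Pi.single i 1) (Function.update c i 0) =
      (0 : Matrix (Fin k) (Fin k) Bit) := by
    rw [Matrix.vecMulVec_mul_vecMulVec, dotProduct_single, Function.update_self]
    simp
  rw [shearMatrix, add_mul, mul_add, mul_add, h0, one_mul, one_mul, mul_one, add_zero, add_assoc,
    h2, add_zero]

lemma shearMatrix_mul_row (i : Fin k) (c : Bits k) (A : Matrix (Fin k) (Fin d) Bit) :
    (shearMatrix i c * A) i = Function.update c i 1 ᵥ* A := by
  have hu : Function.update c i 1 = Pi.single i 1 + Function.update c i 0 := by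
    funext j
    by_cases hj : j = i
    · subst hj; simp
    · simp [hj]
  have hm : shearMatrix i c * A =
      A + Matrix.vecMulVec (Pi.single i 1) (Function.update c i 0 ᵥ* A) := by
    rw [shearMatrix, Matrix.add_mul, Matrix.one_mul, Matrix.vecMulVec_mul]
  rw [hm, hu, Matrix.add_vecMul, Matrix.single_one_vecMul]
  funext j
  simp [Matrix.vecMulVec_apply]

/-- Left multiplication of full rank matrices by `shearMatrix`. -/
def shear (i : Fin k) (c : Bits k) : Equiv.Perm (FullRank k d) :=
  Function.Involutive.toPerm
    (fun A => ⟨shearMatrix i c * A.1, by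
      rw [Matrix.rank_mul_eq_right_of_isUnit_det, A.2]
      exact Matrix.isUnit_det_of_left_inverse (shearMatrix_mul_self i c)⟩)
    (fun A => Subtype.ext (by
      change shearMatrix i c * (shearMatrix i c * A.1) = A.1
      rw [← Matrix.mul_assoc, shearMatrix_mul_self, Matrix.one_mul]))

open Classical in
-- Row `i` of the sheared matrix vanishes only if `c`, with coordinate `i` set to `1`, lies in the
-- left kernel, which has `2^(k-d)` elements. Forgetting coordinate `i` at most doubles the count,
-- giving `2 · 2^(k-d)` of the `2^k` choices. The randomness of `c` alone suffices, so full rank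
-- matrices never have to be counted.
lemma expect_shear_row_eq_zero (i : Fin k) (A : FullRank k d) :
    𝔼 c : Bits k, (if (shear i c A).1 i = 0 then (1 : ℝ) else 0) ≤ 2 / 2 ^ d := by
  have hcard := card_ker_vecMul A.2
  set K : Finset (Bits k) := Finset.univ.filter fun x => x ᵥ* A.1 = 0 with hK
  have hKc : (K.card : ℝ) * 2 ^ d = 2 ^ k := by
    rw [Nat.card_eq_fintype_card, Fintype.card_subtype] at hcard
    exact_mod_cast hcard
  have hsub : (Finset.univ.filter fun c : Bits k => (shear i c A).1 i = 0) ⊆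
      K ∪ K.image fun x => x + Pi.single i 1 := by
    intro c hc
    have hc' : Function.update c i 1 ∈ K := by
      rw [Finset.mem_filter] at hc
      rw [hK, Finset.mem_filter, ← shearMatrix_mul_row]
      exact ⟨Finset.mem_univ _, hc.2⟩
    rw [Finset.mem_union, Finset.mem_image]
    rcases bit_cases (c i) with h | h
    · refine Or.inr ⟨_, hc', ?_⟩
      funext j
      by_cases hj : j = i
      · subst hj; simp [h]; rfl
      · simp [hj]
    · left
      rwa [← h, Function.update_eq_self] at hc'
  have hle : ((Finset.univ.filter fun c : Bits k => (shear i c A).1 i = 0).card : ℝ) ≤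
      2 * K.card := by
    have h1 := (Finset.card_le_card hsub).trans (Finset.card_union_le _ _)
    have h2 : (K.image fun x => x + Pi.single i 1).card ≤ K.card := Finset.card_image_le
    have h3 := h1.trans (Nat.add_le_add_left h2 _)
    rw [← two_mul] at h3
    exact_mod_cast h3
  rw [Fintype.expect_eq_sum_div_card, Finset.sum_boole, Fintype.card_fun, ZMod.card,
    Fintype.card_fin, div_le_div_iff₀ (by positivity) (by positivity)]
  push_cast
  calc _ ≤ 2 * (K.card : ℝ) * 2 ^ d := mul_le_mul_of_nonneg_right hle (by positivity)
    _ = 2 * 2 ^ k := by rw [mul_assoc, hKc]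

end RandomMatrix

/-! ### Cosets with an empty half are rare -/

section Rare

variable {v r d k : ℕ}

open Classical in
/-- The indicator of the event that row `i` of `A_y` vanishes. -/
def rowInd (i : Fin k) (ω : CosetCoins r d k) (y : Bits r) : ℝ :=
  if ω.mat y i = 0 then 1 else 0

/-- If the first row has a non-zero entry in column `j`, then the coset elements at `0` and at the
`j`-th unit vector have different first bits. -/
lemma badInd_le_rowInd (hk : 0 < k) (ω : CosetCoins r d k) (y : Bits r) :
    badInd ω y ≤ rowInd ⟨0, hk⟩ ω y := by
  unfold badInd rowInd
  by_cases h : ω.mat y ⟨0, hk⟩ = 0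
  · rw [if_pos h]
    split_ifs <;> norm_num
  · rw [if_neg h, if_pos]
    obtain ⟨j, hj⟩ := Function.ne_iff.mp h
    have hj1 : ω.mat y ⟨0, hk⟩ j = 1 := (bit_cases _).resolve_left hj
    intro c
    have hfirst : ∀ x, firstBit (ω.mat y *ᵥ x + ω.vec y) =
        (ω.mat y *ᵥ x) ⟨0, hk⟩ + firstBit (ω.vec y) := fun x => by
      rw [firstBit_add]
      simp [firstBit, hk]
    have hcase : ∀ a b : Bit, b = a ∨ 1 + a = b := by decide
    rcases hcase (firstBit (ω.vec y)) c with hc | hc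
    · exact ⟨_, (mem_cosetHalf _ _).mpr ⟨⟨0, rfl⟩, by rw [hfirst]; simp [hc]⟩⟩
    · exact ⟨_, (mem_cosetHalf _ _).mpr ⟨⟨Pi.single j 1, rfl⟩, by
        rw [hfirst, Matrix.mulVec_single_one, Matrix.col_apply, hj1, hc]⟩⟩

/-- Apply `shear` to all matrices of all setup randomness. -/
def shearOracle (i : Fin k) (c : Bits k) : Equiv.Perm (Bits v → CosetCoins r d k) :=
  Equiv.piCongrRight fun _ => Equiv.prodCongr (Equiv.refl _)
    (Equiv.piCongrRight fun _ => Equiv.prodCongr (shear i c) (Equiv.refl _))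

/-- A uniformly random function stays uniform after shearing all its matrices, so an average over
`c` may be inserted for free. Exchanging the averages reduces to one fixed matrix. -/
lemma expect_rowInd_le (i : Fin k) (vk : Bits v) (y : Bits r) :
    𝔼 f : Bits v → CosetCoins r d k, rowInd i (f vk) y ≤ 2 / 2 ^ d := by
  by_cases hne : Nonempty (Bits v → CosetCoins r d k)
  · have h1 : ∀ c : Bits k, 𝔼 f : Bits v → CosetCoins r d k, rowInd i (f vk) y =
        𝔼 f : Bits v → CosetCoins r d k, rowInd i (shearOracle i c f vk) y := fun c =>
      (Fintype.expect_equiv (shearOracle i c) _ _ fun f => rfl).symm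
    calc 𝔼 f : Bits v → CosetCoins r d k, rowInd i (f vk) y =
          𝔼 _c : Bits k, 𝔼 f : Bits v → CosetCoins r d k, rowInd i (f vk) y := by
          rw [Fintype.expect_const]
      _ = 𝔼 c : Bits k, 𝔼 f : Bits v → CosetCoins r d k, rowInd i (shearOracle i c f vk) y :=
          Finset.expect_congr rfl fun c _ => h1 c
      _ = 𝔼 f : Bits v → CosetCoins r d k, 𝔼 c : Bits k, rowInd i (shearOracle i c f vk) y :=
          Finset.expect_comm _ _ _
      _ ≤ _ := Finset.expect_le Finset.univ_nonempty fun f _ =>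
          expect_shear_row_eq_zero i ((f vk).2 y).1
  -- If no setup randomness exists, the expectation over the empty type is zero.
  · rw [not_nonempty_iff] at hne
    rw [Finset.univ_eq_empty, Finset.expect_empty]
    positivity

end Rare

/-! ### The distinguisher -/

section Distinguisher

variable {v r d k : ℕ}

/-- The position of a wire which carries the constant `b`. -/
def constWire (b : Bit) : ℕ := if b = 1 then 1 else 0

/-- A circuit which decides whether the first `j` entries of row `i` of `A_y` vanish, for the setup
randomness at `vk`. -/
def rowCircuit (vk : Bits v) (y : Bits r) (i : Fin k) : ℕ → Circuit v r d k
  | 0 => [Gate.const 0, Gate.const 1]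
  | j + 1 => rowCircuit vk y i j ++
      [if h : j < d then Gate.mat (fun a => constWire (vk a)) (fun a => constWire (y a)) i ⟨j, h⟩
        else Gate.const 0,
      Gate.op (fun p a => p * (1 - a)) (2 * j + 1) (2 * j + 2)]

lemma size_rowCircuit_le (vk : Bits v) (y : Bits r) (i : Fin k) (j : ℕ) :
    (rowCircuit (d := d) vk y i j).size ≤ 2 + j * (v + r + 4) := by
  induction j with
  | zero => simp [rowCircuit, Circuit.size, Gate.size]
  | succ j ih =>
    have h1 : ∀ C C' : Circuit v r d k, Circuit.size (C ++ C') = C.size + C'.size := fun C C' => by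
      simp [Circuit.size]
    rw [rowCircuit, h1]
    have h2 : Circuit.size [if h : j < d then
          Gate.mat (fun a => constWire (vk a)) (fun a => constWire (y a)) i ⟨j, h⟩
        else (Gate.const 0 : Gate v r d k),
      Gate.op (fun p a => p * (1 - a)) (2 * j + 1) (2 * j + 2)] ≤ v + r + 4 := by
      split_ifs <;> simp [Circuit.size, Gate.size]
    exact (Nat.add_le_add ih h2).trans_eq (by ring)

lemma wires_append_pair (C : Circuit v r d k) (g g' : Gate v r d k)
    (f : Bits v → CosetCoins r d k) :
    Circuit.wires (C ++ [g, g']) f = C.wires f ++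
      [g.value f (C.wires f), g'.value f (C.wires f ++ [g.value f (C.wires f)])] := by
  simp [Circuit.wires, List.foldl_append]

/-- Loop invariant. Wires `0` and `1` carry the constants used to hardwire `vk` and `y`, and wire `2
* j + 1` carries the conjunction over the first `j` entries. For `j = 0` that wire is the constant
`1`, the empty conjunction; each round puts the next entry on wire `2 * j + 2` and the new
conjunction on `2 * j + 3`. -/
lemma wires_rowCircuit (vk : Bits v) (y : Bits r) (i : Fin k) (f : Bits v → CosetCoins r d k)
    (j : ℕ) (hj : j ≤ d) :
    ∃ w : List Bit, (rowCircuit vk y i j).wires f = w ∧ w.length = 2 * j + 2 ∧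
      w.getD 0 0 = 0 ∧ w.getD 1 0 = 1 ∧
      (w.getD (2 * j + 1) 0 = 1 ↔ ∀ l : Fin d, l.val < j → (f vk).mat y i l = 0) := by
  induction j with
  | zero =>
    refine ⟨_, rfl, ?_⟩
    simp [rowCircuit, Circuit.wires, Gate.value]
  | succ j ih =>
    obtain ⟨w, hw, hlen, h0, h1, hlast⟩ := ih (by omega)
    have hjd : j < d := by omega
    have hconst : ∀ b : Bit, w.getD (constWire b) 0 = b := fun b => by
      rcases bit_cases b with rfl | rfl
      · exact h0
      · exact h1
    refine ⟨_, rfl, ?_⟩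
    rw [rowCircuit, wires_append_pair, hw, dif_pos hjd]
    simp only [Gate.value, hconst]
    rw [List.getD_append _ _ _ (2 * j + 1) (by omega),
      List.getD_append_right _ _ _ (2 * j + 2) (by omega), hlen, Nat.sub_self,
      List.getD_append _ _ _ 0 (by omega), List.getD_append _ _ _ 1 (by omega),
      List.getD_append_right _ _ _ (2 * (j + 1) + 1) (by omega), hlen,
      show 2 * (j + 1) + 1 - (2 * j + 2) = 1 by omega]
    refine ⟨by simp [hlen]; ring, h0, h1, ?_⟩
    have hprod : ∀ a b : Bit, a * (1 - b) = 1 ↔ a = 1 ∧ b = 0 := by decide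
    simp only [List.getD_cons_zero, List.getD_cons_succ]
    rw [hprod, hlast]
    constructor
    · rintro ⟨h2, h3⟩ l hl
      rcases Nat.lt_succ_iff_lt_or_eq.mp hl with h4 | h4
      · exact h2 l h4
      · have : l = ⟨j, hjd⟩ := Fin.ext h4
        rw [this]
        exact h3
    · intro h2
      exact ⟨fun l hl => h2 l (by omega), h2 ⟨j, hjd⟩ (Nat.lt_succ_self j)⟩

lemma output_rowCircuit (vk : Bits v) (y : Bits r) (i : Fin k) (f : Bits v → CosetCoins r d k) :
    (rowCircuit vk y i d).output f = rowInd i (f vk) y := by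
  obtain ⟨w, hw, hlen, -, -, hlast⟩ := wires_rowCircuit vk y i f d le_rfl
  unfold Circuit.output rowInd
  refine if_congr ?_ rfl rfl
  have hget : w.getLast? = some (w.getD (2 * d + 1) 0) := by
    rw [List.getLast?_eq_getElem?, hlen, show 2 * d + 2 - 1 = 2 * d + 1 by omega,
      List.getD_eq_getElem?_getD, List.getElem?_eq_getElem (by omega)]
    rfl
  rw [hw, hget, Option.some_inj, hlast]
  exact ⟨fun h => funext fun l => h l l.2, fun h l _ => congrFun h l⟩

end Distinguisher

/-! ### Negligible functions -/

lemma Negligible.sqrt {ε : ℕ → ℝ} (h : Negligible ε) : Negligible fun n => √(ε n) := by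
  intro z
  -- The exponent is doubled because the root of `n^(2z) ε` is `n^z √ε`.
  have h1 := (Real.continuous_sqrt.tendsto 0).comp (h (2 * z))
  rw [Real.sqrt_zero] at h1
  refine h1.congr fun n => ?_
  rw [Function.comp_apply, Real.sqrt_mul (by positivity), mul_comm 2 z, pow_mul,
    Real.sqrt_sq (by positivity)]

lemma negligible_two_div_two_pow : Negligible fun n => 2 / 2 ^ dParam n := by
  intro z
  have h := (tendsto_pow_const_mul_const_pow_of_abs_lt_one z (r := (1 / 2 : ℝ) ^ 24)
    (by rw [abs_of_nonneg (by positivity)]; norm_num)).const_mul 2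
  rw [mul_zero] at h
  refine h.congr fun n => ?_
  change _ = (n : ℝ) ^ z * (2 / 2 ^ (24 * n))
  rw [pow_mul, div_pow, one_pow, div_pow, one_pow]
  ring

lemma Negligible.of_eventually_le {ε δ : ℕ → ℝ} (h : Negligible δ) (h0 : ∀ n, 0 ≤ ε n)
    (hle : ∀ n, 0 < n → ε n ≤ δ n) : Negligible ε := by
  refine Asymptotics.SuperpolynomialDecay.trans_eventuallyLE
    (Filter.Eventually.of_forall fun n => Nat.cast_nonneg n)
    (Asymptotics.superpolynomialDecay_zero _ _) h (Filter.Eventually.of_forall h0) ?_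
  filter_upwards [Filter.eventually_gt_atTop 0] with n hn using hle n hn

lemma exists_max_expect_bad {v r d k : ℕ} (F : KeyedFunction v (CosetCoins r d k)) :
    ∃ p : Bits v × Bits r, ∀ q : Bits v × Bits r,
      𝔼 key, badInd (F.eval key q.1) q.2 ≤ 𝔼 key, badInd (F.eval key p.1) p.2 :=
  Finite.exists_max fun p : Bits v × Bits r => 𝔼 key, badInd (F.eval key p.1) p.2

/-- For a pseudorandom function, no coset used in the construction is likely to have an empty half. -/
theorem exists_negligible_bad (oss : ℕ → OneShotSignature)
    (prf : ∀ lam, KeyedFunction (oss lam).vkLen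
      (CosetCoins (rParam lam) (dParam lam) (nParam lam)))
    (hvk : PolyBounded fun lam => (oss lam).vkLen) (hprf : Pseudorandom prf) :
    ∃ B : ℕ → ℝ, Negligible B ∧
      ∀ lam vk y, 𝔼 key, badInd ((prf lam).eval key vk) y ≤ B lam := by
  -- The worst pair `(vk, y)` at each security parameter becomes non-uniform advice for the
  -- circuits. It makes the bound uniform over all pairs.
  have hmax := fun lam => exists_max_expect_bad (prf lam)
  choose p hp using hmax
  refine ⟨_, ?_, fun lam vk y => hp lam (vk, y)⟩
  set C : ∀ lam, Circuit (oss lam).vkLen (rParam lam) (dParam lam) (nParam lam) := fun lam =>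
    if h : 0 < nParam lam then rowCircuit (p lam).1 (p lam).2 ⟨0, h⟩ (dParam lam) else [] with hC
  have hsize : PolyBounded fun lam => (C lam).size := by
    obtain ⟨P, hP⟩ := hvk
    refine ⟨2 + 24 * Polynomial.X * (P + 16 * Polynomial.X * Polynomial.X + 4), fun lam => ?_⟩
    have h1 : (C lam).size ≤ 2 + dParam lam * ((oss lam).vkLen + rParam lam + 4) := by
      simp only [hC]
      split_ifs
      · exact size_rowCircuit_le ..
      · simp [Circuit.size]
    have h2 : rParam lam ≤ 16 * lam * lam := Nat.mul_le_mul_left _ (Nat.sub_le _ _)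
    have h3 := hP lam
    refine h1.trans ?_
    simp only [Polynomial.eval_add, Polynomial.eval_mul, Polynomial.eval_ofNat, Polynomial.eval_X]
    unfold dParam
    gcongr
  -- The bad probability is at most the distinguishing advantage plus the probability for a random
  -- function. At security parameter `0` the ambient dimension is `0` and there is no first row, so
  -- the comparison is made for positive parameters only.
  refine Negligible.of_eventually_le ((hprf C hsize).add negligible_two_div_two_pow)
    (fun lam => ?_) fun lam hlam => ?_
  · refine Finset.expect_nonneg fun key _ => ?_
    unfold badInd
    split_ifs <;> norm_num
  · have hn : 0 < nParam lam := by unfold nParam dParam; omega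
    have hCl : C lam = rowCircuit (p lam).1 (p lam).2 ⟨0, hn⟩ (dParam lam) := dif_pos hn
    have h1 : 𝔼 key, badInd ((prf lam).eval key (p lam).1) (p lam).2 ≤
        𝔼 key, (C lam).output ((prf lam).eval key) := by
      refine Finset.expect_le_expect fun key _ => ?_
      rw [hCl, output_rowCircuit]
      exact badInd_le_rowInd hn _ _
    have h2 : 𝔼 f, (C lam).output f ≤ 2 / 2 ^ dParam lam := by
      simp only [hCl, output_rowCircuit]
      exact expect_rowInd_le _ _ _
    have h3 := le_abs_self ((𝔼 key, (C lam).output ((prf lam).eval key)) - 𝔼 f, (C lam).output f)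
    simp only [Pi.add_apply]
    linarith

theorem scheme_correct (oss : ℕ → OneShotSignature)
    (prf : ∀ lam, KeyedFunction (oss lam).vkLen
      (CosetCoins (rParam lam) (dParam lam) (nParam lam)))
    (hoss : OneShotSignature.Correct oss) (hvk : PolyBounded fun lam => (oss lam).vkLen)
    (hprf : Pseudorandom prf) : PauliFunctionalCommitment.Correct (scheme oss prf) := by
  obtain ⟨B, hB, hbad⟩ := exists_negligible_bad oss prf hvk hprf
  exact ⟨_, ((hoss 0).sqrt.add (hoss 1)).add hB, fun lam ρ hρ htr =>
    tvDist_pfc_le (prf lam) (hbad lam) hρ htr⟩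

end PFC

end

theorem mainTheorem9 :
    (∀ (oss : ℕ → PFC.OneShotSignature)
      (prf : ∀ lam, PFC.KeyedFunction (oss lam).vkLen
        (PFC.CosetCoins (PFC.rParam lam) (PFC.dParam lam) (PFC.nParam lam))),
      PFC.OneShotSignature.Correct oss →
      PFC.PolyBounded (fun lam => (oss lam).vkLen) →
      PFC.Pseudorandom prf →
      PFC.PauliFunctionalCommitment.Correct (PFC.scheme oss prf)) ∧
    (∀ (k d : ℕ) (A : Matrix (Fin k) (Fin d) PFC.Bit) (v : PFC.Bits k),
      (∀ c, (PFC.cosetHalf A v c).Nonempty) →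
      ∀ c : PFC.Bit,
        (PFC.hadamardPow k).mulVec
            (PFC.phase (fun s => open Classical in if s ∈ PFC.dual A then 0 else 1)
              ((PFC.hadamardPow k).mulVec (PFC.uniformState (PFC.cosetHalf A v (1 - c))))) =
          PFC.uniformState (PFC.cosetHalf A v c)) := by
  exact ⟨PFC.scheme_correct, fun k d A v h c => PFC.rotate_uniformState h c⟩
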